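/- **Setting.** Let $\mathcal X,\mathcal Y$ be finite-dimensional real inner product spaces. For a set $S$, $\overline{\mathrm{Conv}}(S)$ is the set of proper lower semicontinuous convex functions with values in $(-\infty,\infty]$ and effective domain $S$; for $\varepsilon\ge 0$, $\partial_\varepsilon\psi(z)=\{w:\psi(z')\ge\psi(z)+\langle w,z'-z\rangle-\varepsilon\ \forall z'\}$ and $\partial=\partial_0$; $\log_1^+(t)=\max\{1,\log t\}$. Consider $$\min_{x\in X}\{\hat p(x):=p(x)+h(x)\},\qquad p(x):=\max_{y\in Y}\Phi(x,y),$$ under the assumptions: $X\subseteq\mathcal X$, $Y\subseteq\mathcal Y$ are nonempty and convex, $Y$ is compact; there is an open $\Omega\supseteq X$ such that $\Phi$ is continuous on $\Omega\times Y$, $\nabla_x\Phi$ exists and is continuous on $\Omega\times Y$, and $-\Phi(x,\cdot)\in\overline{\mathrm{Conv}}(Y)$ for $x\in\Omega$; $h\in\overline{\mathrm{Conv}}(X)$; $L_x,L_y>0$, $m\in(0,L_x]$ and, for all $x,x'\in X$, $y,y'\in Y$, $$\Phi(x,y)-\Phi(x',y)-\langle\nabla_x\Phi(x',y),x-x'\rangle\ge-\tfrac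 m2\|x-x'\|^2,\qquad \|\nabla_x\Phi(x,y)-\nabla_x\Phi(x',y')\|\le L_x\|x-x'\|+L_y\|y-y'\|;$$ and $\inf_X\hat p>-\infty$. Let $D_y:=\sup_{y,y'\in Y}\|y-y'\|$. For $x_0\in X$ let $$R(\hat p;\lambda):=\inf_{x'\in X}\left\{\tfrac12\|x_0-x'\|^2+\lambda\left[\hat p(x')-\inf_X\hat p\right]\right\}.$$ For $\xi>0$ and $y_0\in Y$ let $p_\xi(x):=\max_{y\in Y}\{\Phi(x,y)-\frac1{2\xi}\|y-y_0\|^2\}$, let $y_\xi(x)$ be the unique maximizer, and let $$L_\xi:=L_y\left(\xi L_y+\sqrt{\xi(L_x+m)}\right)+L_x,\qquad \Omega_\xi:=1+\frac{\sqrt\xi L_y+\sqrt{L_x}}{\sqrt m}.$$ **ACG method** (inputs $\mu,L>0$, $\psi_n$ with domain $X$, $\psi_s$, $z_0\in X$). Put $y^0=z^0=z_0$, $A_0=0$, $\Gamma_0\equiv0$ and, for $j\ge0$, with $\psi=\psi_s+\psi_n$, $$A_{j+1}=A_j+\frac{\mu A_j+1+\sqrt{(\mu A_j+1)^2+4L(\mu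 A_j+1)A_j}}{2L},\qquad \theta_j=\frac{A_j}{A_{j+1}},$$ $$\tilde z^j=\theta_jz^j+(1-\theta_j)y^j,\qquad \Gamma_{j+1}=\theta_j\Gamma_j+(1-\theta_j)\left[\psi_s(\tilde z^j)+\langle\nabla\psi_s(\tilde z^j),\cdot-\tilde z^j\rangle\right],$$ $$y^{j+1}=\operatorname{argmin}\left\{\Gamma_{j+1}+\psi_n+\tfrac1{2A_{j+1}}\|\cdot-y^0\|^2\right\},\qquad z^{j+1}=\theta_jz^j+(1-\theta_j)y^{j+1},$$ $$u_{j+1}=\frac{y^0-y^{j+1}}{A_{j+1}},\qquad \varepsilon_{j+1}=\psi(z^{j+1})-\Gamma_{j+1}(y^{j+1})-\psi_n(y^{j+1})-\langle u_{j+1},z^{j+1}-y^{j+1}\rangle .$$ **AIPP-S scheme** (inputs $m,L_x,L_y$, $\xi>0$, $(x_0,y_0)\in X\times Y$, tolerance $\rho>0$). Put $\sigma=\frac12$, $\lambda=\frac1{4m}$, $M=L_\xi$, $M_\lambda=M+\lambda^{-1}$, $\hat\rho=\rho/4$, $\hat\varepsilon=\rho^2/(32M_\lambda)$, $N=\lceil6\sqrt{2\lambda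 M+1}\rceil$, $k=1$. 1. Run ACG with $z_0=x_{k-1}$, $(\mu,L)=(\frac12,\lambda M+\frac12)$, $\psi_s=\lambda p_\xi+\frac14\|\cdot-x_{k-1}\|^2$, $\psi_n=\lambda h+\frac14\|\cdot-x_{k-1}\|^2$, up to the first iterate $(x,u,\varepsilon)=(z^j,u_j,\varepsilon_j)$ with $j\ge N$ such that $\varepsilon\ge0$ and $$u\in\partial_\varepsilon\left(\lambda(p_\xi+h)+\tfrac12\|\cdot-x_{k-1}\|^2\right)(x),\qquad \|u\|^2+2\varepsilon\le\sigma\|x_{k-1}-x+u\|^2.\tag{$*$}$$ 2. If $\|x_{k-1}-x+u\|\le\lambda\hat\rho/5$, go to 3; otherwise put $x_k=x$, increase $k$ by 1 and go to 1. 3. Restart the last ACG call and run it up to the first iterate $(x,u,\varepsilon)$ of index $j\ge N$ that satisfies $(*)$ and $\varepsilon\le\hat\varepsilon\lambda$. 4. Put $\bar x=\operatorname{argmin}_{x'}\{\langle\nabla p_\xi(x),x'-x\rangle+h(x')+\frac{M_\lambda}2\|x'-x\|^2\}$ and $\bar u=M_\lambda(x-\bar x)+\nabla p_\xi(\bar x)-\nabla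 p_\xi(x)$, and output $(\bar x,\bar u)$. **Oracles.** Exact oracles are available for $\Phi(x,y)$, $\nabla_x\Phi(x,y)$, $h(x)$ at $x\in X$, $y\in Y$, and for the solutions of $\min_{x\in X}\{th(x)+\frac12\|x-a\|^2\}$ and $\max_{y\in Y}\{t\Phi(x,y)-\frac12\|y-b\|^2\}$ with $t>0$, $a\in\mathcal X$, $x\in X$, $b\in\mathcal Y$. An oracle call is a collection of boundedly many evaluations of these, each of them occurring at least once; up to a universal factor it suffices to count all single evaluations. The scheme evaluates $p_\xi(x)$ and $\nabla p_\xi(x)=\nabla_x\Phi(x,y_\xi(x))$ through $y_\xi(x)$, which is one evaluation of the last oracle, and computes each of the minimizers in ACG and in step 4 by one evaluation of the oracle for $h$. **Proposition 3.2.** Let $\rho_x,\rho_y>0$, and run the AIPP-S scheme with $\xi>0$, $\xi\ge D_y/\rho_y$ and $\rho=\rho_x$. (a) The scheme terminates, and it performs $$\mathcal O\left(\Omega_\xi\left[\frac{m^2R(\hat p;1/(4m))}{\rho_x^2}+\frac{mD_y^2}{\xi\rho_x^2}+\log_1^+(\Omega_\xi)\right]\right)$$ oracle calls, where the constant in $\mathcal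 O$ is universal. If moreover $\xi=D_y/\rho_y$ (so that $D_y>0$), then for $\rho_x,\rho_y\in(0,1]$ with $\log(1/\rho_y)\le B\rho_x^{-2}$ this is $\mathcal O(\rho_x^{-2}\rho_y^{-1/2})$, where the constant depends only on $m$, $L_x$, $L_y$, $D_y$, $R(\hat p;1/(4m))$ and $B$. (b) If $(x,u)$ is the output, then with $\bar y:=y_\xi(x)$ and $\bar v:=(y_0-\bar y)/\xi$ the quadruple $(u,\bar v,x,\bar y)$ is a $(\rho_x,\rho_y)$-primal-dual stationary point, i.e. $u\in\nabla_x\Phi(x,\bar y)+\partial h(x)$, $\bar v\in\partial[-\Phi(x,\cdot)](\bar y)$, $\|u\|\le\rho_x$ and $\|\bar v\|\le\rho_y$. -/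

import Mathlib

namespace MinMaxSmoothing

noncomputable section

/-! ### Convex analysis

A function `Z → (-∞, ∞]` with effective domain `S` is represented by the set `S` and a real-valued
function whose values outside `S` are irrelevant (the value there is `+∞`). -/

section Convex

variable {Z : Type*} [NormedAddCommGroup Z] [InnerProductSpace ℝ Z]

open Classical in
/-- The extended-real-valued function equal to `ψ` on `S` and to `+∞` outside `S`. -/
def extendTop (S : Set Z) (ψ : Z → ℝ) : Z → EReal :=
  fun z => if z ∈ S then (ψ z : EReal) else ⊤

/-- Proper lower semicontinuous convex functions whose effective domain is exactly `S`. -/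
structure ClosedConvexFn (S : Set Z) (ψ : Z → ℝ) : Prop where
  nonempty : S.Nonempty
  convexOn : ConvexOn ℝ S ψ
  lsc : LowerSemicontinuous (extendTop S ψ)

/-- The `ε`-subdifferential at `z` of the function equal to `ψ` on `S` and to `+∞` outside `S`. -/
def epsSubdiff (S : Set Z) (ψ : Z → ℝ) (ε : ℝ) (z : Z) : Set Z :=
  {w | z ∈ S ∧ ∀ z' ∈ S, ψ z + inner ℝ w (z' - z) - ε ≤ ψ z'}

/-- The subdifferential. -/
def subdiff (S : Set Z) (ψ : Z → ℝ) (z : Z) : Set Z := epsSubdiff S ψ 0 z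

/-- `z` is a minimizer over the whole space of the function equal to `ψ` on `S`, `+∞` outside. -/
def IsArgmin (S : Set Z) (ψ : Z → ℝ) (z : Z) : Prop := z ∈ S ∧ IsMinOn ψ S z

/-- `z` is a maximizer of `ψ` over `S`. -/
def IsArgmax (S : Set Z) (ψ : Z → ℝ) (z : Z) : Prop := z ∈ S ∧ IsMaxOn ψ S z

/-- `R(φ; λ) = inf_{x'} { ‖x₀ - x'‖² / 2 + λ (φ(x') - inf φ) }` for a function `φ` with domain
`S`. -/
def Rfun (S : Set Z) (φ : Z → ℝ) (x₀ : Z) (lam : ℝ) : ℝ :=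
  sInf ((fun x' => ‖x₀ - x'‖ ^ 2 / 2 + lam * (φ x' - sInf (φ '' S))) '' S)

end Convex

/-- `log₁⁺ t = max {1, log t}`. -/
def logOnePlus (t : ℝ) : ℝ := max 1 (Real.log t)

/-! ### The accelerated composite gradient (ACG) method -/

/-- The sequences generated by the ACG method; `ztil j` is the auxiliary point at which `ψ_s` is
linearized, `Gam j` is the affine minorant `Γ_j`. -/
structure ACGTrace (E : Type*) where
  A : ℕ → ℝ
  ztil : ℕ → E
  Gam : ℕ → E → ℝ
  y : ℕ → E
  z : ℕ → E
  u : ℕ → E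
  eps : ℕ → ℝ

section Methods

variable {E : Type*} [NormedAddCommGroup E] [InnerProductSpace ℝ E] [CompleteSpace E]

/-- `T` consists of the sequences generated by the ACG method with inputs `(μ, L)`, `(ψ_n, ψ_s)`
and `z₀`, where `X` is the effective domain of `ψ_n`. -/
structure IsACG (X : Set E) (ψs ψn : E → ℝ) (μ L : ℝ) (z₀ : E) (T : ACGTrace E) : Prop where
  A_zero : T.A 0 = 0
  y_zero : T.y 0 = z₀
  z_zero : T.z 0 = z₀
  Gam_zero : ∀ v, T.Gam 0 v = 0
  A_succ : ∀ j, T.A (j + 1) = T.A j +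
    (μ * T.A j + 1 + √((μ * T.A j + 1) ^ 2 + 4 * L * (μ * T.A j + 1) * T.A j)) / (2 * L)
  ztil_eq : ∀ j, T.ztil j = (T.A j / T.A (j + 1)) • T.z j +
    ((T.A (j + 1) - T.A j) / T.A (j + 1)) • T.y j
  Gam_succ : ∀ j v, T.Gam (j + 1) v = T.A j / T.A (j + 1) * T.Gam j v +
    (T.A (j + 1) - T.A j) / T.A (j + 1) *
      (ψs (T.ztil j) + inner ℝ (gradient ψs (T.ztil j)) (v - T.ztil j))
  y_succ : ∀ j, IsArgmin X
    (fun v => T.Gam (j + 1) v + ψn v + 1 / (2 * T.A (j + 1)) * ‖v - T.y 0‖ ^ 2) (T.y (j + 1))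
  z_succ : ∀ j, T.z (j + 1) = (T.A j / T.A (j + 1)) • T.z j +
    ((T.A (j + 1) - T.A j) / T.A (j + 1)) • T.y (j + 1)
  u_succ : ∀ j, T.u (j + 1) = (1 / T.A (j + 1)) • (T.y 0 - T.y (j + 1))
  eps_succ : ∀ j, T.eps (j + 1) = (ψs (T.z (j + 1)) + ψn (T.z (j + 1)))
    - T.Gam (j + 1) (T.y (j + 1)) - ψn (T.y (j + 1))
    - inner ℝ (T.u (j + 1)) (T.z (j + 1) - T.y (j + 1))

/-! ### The accelerated inexact proximal point (AIPP) method -/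

/-- Scalar inputs of the AIPP method: the curvature constant `M`, the stepsize `λ`, the relative
error `σ` and the tolerance `ρ̄`. -/
structure AIPPParams where
  M : ℝ
  lam : ℝ
  sigma : ℝ
  rho : ℝ

namespace AIPPParams

/-- `ρ̂ = ρ̄ / 4` -/
def rhoHat (p : AIPPParams) : ℝ := p.rho / 4

/-- `ε̂ = ρ̄² / (32 (M + λ⁻¹))` -/
def epsHat (p : AIPPParams) : ℝ := p.rho ^ 2 / (32 * (p.M + p.lam⁻¹))

/-- `M_λ = M + λ⁻¹` -/
def Mlam (p : AIPPParams) : ℝ := p.M + p.lam⁻¹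

/-- The minimal number `⌈6 √(2 λ M + 1)⌉` of iterations of every ACG call. -/
def minIter (p : AIPPParams) : ℕ := ⌈6 * √(2 * p.lam * p.M + 1)⌉₊

/-- The strong convexity constant `μ = 1 / 2` passed to the ACG method. -/
def acgMu (_ : AIPPParams) : ℝ := 1 / 2

/-- The Lipschitz constant `L = λ M + 1 / 2` passed to the ACG method. -/
def acgL (p : AIPPParams) : ℝ := p.lam * p.M + 1 / 2

end AIPPParams

/-- The inexact prox criterion with center `c` for the composite function `φ` with domain `X`:
`u ∈ ∂_ε (λ φ + ‖· - c‖² / 2)(x)`, `‖u‖² + 2 ε ≤ σ ‖c - x + u‖²`, where `ε ≥ 0`. -/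
def InexactProx (X : Set E) (φ : E → ℝ) (p : AIPPParams) (c x u : E) (ε : ℝ) : Prop :=
  0 ≤ ε ∧ u ∈ epsSubdiff X (fun v => p.lam * φ v + 1 / 2 * ‖v - c‖ ^ 2) ε x ∧
    ‖u‖ ^ 2 + 2 * ε ≤ p.sigma * ‖c - x + u‖ ^ 2

/-- The data of a complete run of the AIPP method: outer iterations `k = 1, …, K`; `x k` are the
prox centers; `acg k` is the ACG call of outer iteration `k`, ended after `j k` ACG iterations;
the call of step 3 ends after `jFinal` ACG iterations; `(xbar, ubar)` is the output. -/
structure AIPPTrace (E : Type*) where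
  K : ℕ
  x : ℕ → E
  acg : ℕ → ACGTrace E
  j : ℕ → ℕ
  jFinal : ℕ
  xbar : E
  ubar : E

/-- `T` is a complete run of the AIPP method applied to `min f + h`, `X = dom h`, from `x₀`.
Every ACG call ends at the first of its iterates, among those of index at least
`⌈6 √(2 λ M + 1)⌉`, that has the required property. -/
structure IsAIPPRun (X : Set E) (f h : E → ℝ) (p : AIPPParams) (x₀ : E) (T : AIPPTrace E) :
    Prop where
  one_le_K : 1 ≤ T.K
  x_zero : T.x 0 = x₀
  acg_call : ∀ k, 1 ≤ k → k ≤ T.K →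
    IsACG X (fun v => p.lam * f v + 1 / 4 * ‖v - T.x (k - 1)‖ ^ 2)
      (fun v => p.lam * h v + 1 / 4 * ‖v - T.x (k - 1)‖ ^ 2) p.acgMu p.acgL (T.x (k - 1))
      (T.acg k)
  step1 : ∀ k, 1 ≤ k → k ≤ T.K →
    IsLeast {i | p.minIter ≤ i ∧ InexactProx X (fun v => f v + h v) p (T.x (k - 1))
      ((T.acg k).z i) ((T.acg k).u i) ((T.acg k).eps i)} (T.j k)
  step2_continue : ∀ k, 1 ≤ k → k < T.K →
    ¬ ‖T.x (k - 1) - (T.acg k).z (T.j k) + (T.acg k).u (T.j k)‖ ≤ p.lam * p.rhoHat / 5 ∧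
    T.x k = (T.acg k).z (T.j k)
  step2_stop :
    ‖T.x (T.K - 1) - (T.acg T.K).z (T.j T.K) + (T.acg T.K).u (T.j T.K)‖ ≤ p.lam * p.rhoHat / 5
  step3 : IsLeast {i | p.minIter ≤ i ∧ InexactProx X (fun v => f v + h v) p (T.x (T.K - 1))
      ((T.acg T.K).z i) ((T.acg T.K).u i) ((T.acg T.K).eps i) ∧
      (T.acg T.K).eps i ≤ p.epsHat * p.lam} T.jFinal
  step4_xbar : IsArgmin X
    (fun v => inner ℝ (gradient f ((T.acg T.K).z T.jFinal)) (v - (T.acg T.K).z T.jFinal) + h v +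
      p.Mlam / 2 * ‖v - (T.acg T.K).z T.jFinal‖ ^ 2) T.xbar
  step4_ubar : T.ubar = p.Mlam • ((T.acg T.K).z T.jFinal - T.xbar) + gradient f T.xbar -
    gradient f ((T.acg T.K).z T.jFinal)

end Methods

/-! ### The min-max problem -/

/-- The data of `min_{x ∈ X} { max_{y ∈ Y} Φ(x, y) + h(x) }`. -/
structure MinMaxProblem (E F : Type*) where
  X : Set E
  Y : Set F
  Phi : E → F → ℝ
  h : E → ℝ

section Problem

variable {E F : Type*} [NormedAddCommGroup E] [InnerProductSpace ℝ E] [CompleteSpace E]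
  [NormedAddCommGroup F] [InnerProductSpace ℝ F]

namespace MinMaxProblem

/-- `∇ₓ Φ(x, y)` -/
def gradX (P : MinMaxProblem E F) (x : E) (y : F) : E := gradient (fun x' => P.Phi x' y) x

/-- `p(x) = max_{y ∈ Y} Φ(x, y)` -/
def p (P : MinMaxProblem E F) (x : E) : ℝ := sSup ((fun y => P.Phi x y) '' P.Y)

/-- `p̂ = p + h` -/
def phat (P : MinMaxProblem E F) (x : E) : ℝ := P.p x + P.h x

/-- The diameter of `Y`. -/
def Dy (P : MinMaxProblem E F) : ℝ := Metric.diam P.Y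

/-- The standing assumptions on the min-max problem. -/
structure Assumptions (P : MinMaxProblem E F) (m Lx Ly : ℝ) : Prop where
  X_nonempty : P.X.Nonempty
  X_convex : Convex ℝ P.X
  Y_nonempty : P.Y.Nonempty
  Y_convex : Convex ℝ P.Y
  Y_compact : IsCompact P.Y
  smooth : ∃ Ω : Set E, IsOpen Ω ∧ P.X ⊆ Ω ∧
    ContinuousOn (fun q : E × F => P.Phi q.1 q.2) (Ω ×ˢ P.Y) ∧
    (∀ x ∈ Ω, ∀ y ∈ P.Y, DifferentiableAt ℝ (fun x' => P.Phi x' y) x) ∧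
    ContinuousOn (fun q : E × F => P.gradX q.1 q.2) (Ω ×ˢ P.Y) ∧
    ∀ x ∈ Ω, ClosedConvexFn P.Y (fun y => -P.Phi x y)
  h_closedConvex : ClosedConvexFn P.X P.h
  m_pos : 0 < m
  m_le : m ≤ Lx
  Ly_pos : 0 < Ly
  lower_curvature : ∀ x ∈ P.X, ∀ x' ∈ P.X, ∀ y ∈ P.Y,
    -(m / 2) * ‖x - x'‖ ^ 2 ≤ P.Phi x y - (P.Phi x' y + inner ℝ (P.gradX x' y) (x - x'))
  grad_lipschitz : ∀ x ∈ P.X, ∀ x' ∈ P.X, ∀ y ∈ P.Y, ∀ y' ∈ P.Y,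
    ‖P.gradX x y - P.gradX x' y'‖ ≤ Lx * ‖x - x'‖ + Ly * ‖y - y'‖
  bddBelow : BddBelow (P.phat '' P.X)

/-- `(u, v, x, y)` is a `(ρx, ρy)`-primal-dual stationary point:
`u ∈ ∇ₓΦ(x, y) + ∂h(x)`, `v ∈ ∂[-Φ(x, ·)](y)`, `‖u‖ ≤ ρx`, `‖v‖ ≤ ρy`. -/
def IsPrimalDualStationary (P : MinMaxProblem E F) (ρx ρy : ℝ) (u : E) (v : F) (x : E) (y : F) :
    Prop :=
  (∃ s ∈ subdiff P.X P.h x, u = P.gradX x y + s) ∧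
    v ∈ subdiff P.Y (fun y' => -P.Phi x y') y ∧ ‖u‖ ≤ ρx ∧ ‖v‖ ≤ ρy

/-! #### Smoothing -/

/-- `Φ_ξ(x, y) = Φ(x, y) - ‖y - y₀‖² / (2 ξ)` -/
def PhiXi (P : MinMaxProblem E F) (ξ : ℝ) (y₀ : F) (x : E) (y : F) : ℝ :=
  P.Phi x y - 1 / (2 * ξ) * ‖y - y₀‖ ^ 2

/-- `p_ξ(x) = max_{y ∈ Y} Φ_ξ(x, y)` -/
def pXi (P : MinMaxProblem E F) (ξ : ℝ) (y₀ : F) (x : E) : ℝ :=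
  sSup ((fun y => P.PhiXi ξ y₀ x y) '' P.Y)

/-- `y_ξ(x) = argmax_{y ∈ Y} Φ_ξ(x, y)` -/
def yXi (P : MinMaxProblem E F) (ξ : ℝ) (y₀ : F) (x : E) : F :=
  Classical.epsilon (fun y => IsArgmax P.Y (fun y' => P.PhiXi ξ y₀ x y') y)

end MinMaxProblem

/-- `Q_ξ = ξ L_y + √(ξ (L_x + m))` -/
def Qxi (m Lx Ly ξ : ℝ) : ℝ := ξ * Ly + √(ξ * (Lx + m))

/-- `L_ξ = L_y Q_ξ + L_x` -/
def Lxi (m Lx Ly ξ : ℝ) : ℝ := Ly * Qxi m Lx Ly ξ + Lx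

/-- `Ω_ξ = 1 + (√ξ L_y + √L_x) / √m` -/
def OmegaXi (m Lx Ly ξ : ℝ) : ℝ := 1 + (√ξ * Ly + √Lx) / √m

/-! ### The AIPP-S scheme -/

/-- The inputs with which the AIPP-S scheme calls the AIPP method: `M = L_ξ`, `λ = 1 / (4 m)`,
`σ = 1 / 2`, tolerance `ρ`. -/
def aippsParams (m Lx Ly ξ ρ : ℝ) : AIPPParams where
  M := Lxi m Lx Ly ξ
  lam := 1 / (4 * m)
  sigma := 1 / 2
  rho := ρ

/-- `(x, u)` is output by the AIPP-S scheme with smoothing parameter `ξ`, initial point `(x₀, y₀)`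
and tolerance `ρ`: it is the output of the AIPP method applied to `min p_ξ + h`. -/
def MinMaxProblem.IsAIPPSOutput (P : MinMaxProblem E F) (m Lx Ly ξ : ℝ) (x₀ : E) (y₀ : F) (ρ : ℝ)
    (x u : E) : Prop :=
  ∃ T : AIPPTrace E,
    IsAIPPRun P.X (P.pXi ξ y₀) P.h (aippsParams m Lx Ly ξ ρ) x₀ T ∧ x = T.xbar ∧ u = T.ubar

/-! ### Oracle model

The scheme is also written as a program whose only access to `Φ`, `h`, `X` and `Y` is through the
elementary oracles below. An "oracle call" is a collection of at least one and boundedly many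
evaluations of each of the elementary oracles, so, up to a universal factor, the number of oracle
calls needed is at most the total number of elementary oracle evaluations, which is what is
counted. Vector and scalar arithmetic is free. -/

/-- Answers to the elementary queries: `Φ(x, y)`, `∇ₓΦ(x, y)`, `h(x)`, the `h`-resolvent
`argmin_x { t h(x) + ‖x - a‖² / 2 }` and the `[-Φ(x, ·)]`-resolvent
`argmax_y { t Φ(x, y) - ‖y - b‖² / 2 }`. -/
structure Oracle (E F : Type*) where
  phi : E → F → ℝ
  gradPhi : E → F → E
  hval : E → ℝ
  proxH : ℝ → E → E
  proxPhi : ℝ → E → F → F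

/-- The oracle answers correctly on all legitimate queries (nothing is said about the others). -/
structure MinMaxProblem.IsOracle (P : MinMaxProblem E F) (O : Oracle E F) : Prop where
  phi_eq : ∀ x ∈ P.X, ∀ y ∈ P.Y, O.phi x y = P.Phi x y
  gradPhi_eq : ∀ x ∈ P.X, ∀ y ∈ P.Y, O.gradPhi x y = P.gradX x y
  hval_eq : ∀ x ∈ P.X, O.hval x = P.h x
  proxH_spec : ∀ t, 0 < t → ∀ a,
    IsArgmin P.X (fun x => t * P.h x + 1 / 2 * ‖x - a‖ ^ 2) (O.proxH t a)
  proxPhi_spec : ∀ t, 0 < t → ∀ x ∈ P.X, ∀ b,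
    IsArgmax P.Y (fun y => t * P.Phi x y - 1 / 2 * ‖y - b‖ ^ 2) (O.proxPhi t x b)

end Problem

/-- Programs with access to the elementary oracles; each constructor other than `done` makes one
query and continues with the answer. -/
inductive OracleProg (E F α : Type*) where
  | done (a : α)
  | phi (x : E) (y : F) (k : ℝ → OracleProg E F α)
  | gradPhi (x : E) (y : F) (k : E → OracleProg E F α)
  | hval (x : E) (k : ℝ → OracleProg E F α)
  | proxH (t : ℝ) (a : E) (k : E → OracleProg E F α)
  | proxPhi (t : ℝ) (x : E) (b : F) (k : F → OracleProg E F α)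

/-- Run a program against an oracle: the result and the number of elementary oracle evaluations. -/
def OracleProg.run {E F α : Type*} (O : Oracle E F) : OracleProg E F α → α × ℕ
  | .done a => (a, 0)
  | .phi x y k => let r := (k (O.phi x y)).run O; (r.1, r.2 + 1)
  | .gradPhi x y k => let r := (k (O.gradPhi x y)).run O; (r.1, r.2 + 1)
  | .hval x k => let r := (k (O.hval x)).run O; (r.1, r.2 + 1)
  | .proxH t a k => let r := (k (O.proxH t a)).run O; (r.1, r.2 + 1)
  | .proxPhi t x b k => let r := (k (O.proxPhi t x b)).run O; (r.1, r.2 + 1)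

/-- The memory of an ACG call after `j` iterations; `Γ_j = alpha + ⟨beta, ·⟩`. -/
structure ACGState (E : Type*) where
  j : ℕ
  A : ℝ
  alpha : ℝ
  beta : E
  y : E
  z : E
  u : E
  eps : ℝ

/-- Control states of the AIPP-S program: inside the ACG call of step 1 or of step 3 with prox
center `c`, or halted with an output pair. -/
inductive SchemeState (E : Type*) where
  | step1 (c : E) (s : ACGState E)
  | step3 (c : E) (s : ACGState E)
  | halted (xbar ubar : E)

section Program

variable {E F α : Type*} [NormedAddCommGroup E] [InnerProductSpace ℝ E]
  [NormedAddCommGroup F] [InnerProductSpace ℝ F]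

/-- The memory at the start of an ACG call with initial point `c`. -/
def ACGState.init (c : E) : ACGState E where
  j := 0
  A := 0
  alpha := 0
  beta := 0
  y := c
  z := c
  u := 0
  eps := 0

/-- Computes `p_ξ(x)` and `∇p_ξ(x)` by three oracle evaluations, and continues with them. -/
def evalSmoothed (ξ : ℝ) (y₀ : F) (x : E) (k : ℝ → E → OracleProg E F α) : OracleProg E F α :=
  .proxPhi ξ x y₀ fun yx =>
  .phi x yx fun v =>
  .gradPhi x yx fun g =>
  k (v - 1 / (2 * ξ) * ‖yx - y₀‖ ^ 2) g

/-- One iteration of the ACG method for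
`ψ_s = λ p_ξ + ‖· - c‖² / 4` and `ψ_n = λ h + ‖· - c‖² / 4` started from `c`. With
`κ = 1 / 2 + 1 / A_{j+1}` and `Γ_{j+1} = α + ⟨β, ·⟩`, the function minimized by `y_{j+1}` equals, up
to a constant, `κ { (λ / κ) h + ‖· - (c - β / κ)‖² / 2 }`, so `y_{j+1}` is one `h`-resolvent. -/
def acgIteration (p : AIPPParams) (ξ : ℝ) (y₀ : F) (c : E) (s : ACGState E)
    (k : ACGState E → OracleProg E F α) : OracleProg E F α :=
  let A' := s.A + (p.acgMu * s.A + 1 +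
    √((p.acgMu * s.A + 1) ^ 2 + 4 * p.acgL * (p.acgMu * s.A + 1) * s.A)) / (2 * p.acgL)
  let ztil := (s.A / A') • s.z + ((A' - s.A) / A') • s.y
  evalSmoothed ξ y₀ ztil fun pv pg =>
  let sv := p.lam * pv + 1 / 4 * ‖ztil - c‖ ^ 2
  let sg := p.lam • pg + (1 / 2 : ℝ) • (ztil - c)
  let alpha' := s.A / A' * s.alpha + (A' - s.A) / A' * (sv - inner ℝ sg ztil)
  let beta' := (s.A / A') • s.beta + ((A' - s.A) / A') • sg
  let κ := 1 / 2 + 1 / A'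
  .proxH (p.lam / κ) (c - κ⁻¹ • beta') fun y' =>
  let z' := (s.A / A') • s.z + ((A' - s.A) / A') • y'
  let u' := (1 / A') • (c - y')
  evalSmoothed ξ y₀ z' fun pz _ =>
  .hval z' fun hz =>
  .hval y' fun hy =>
  let eps' := (p.lam * pz + 1 / 4 * ‖z' - c‖ ^ 2 + (p.lam * hz + 1 / 4 * ‖z' - c‖ ^ 2))
    - (alpha' + inner ℝ beta' y') - (p.lam * hy + 1 / 4 * ‖y' - c‖ ^ 2) - inner ℝ u' (z' - y')
  k { j := s.j + 1, A := A', alpha := alpha', beta := beta', y := y', z := z', u := u',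
      eps := eps' }

/-- The acceptance test of an ACG iterate in the call with prox center `c`: enough iterations, and
the relative error inequality. -/
def ACGState.accept (p : AIPPParams) (c : E) (s : ACGState E) : Prop :=
  p.minIter ≤ s.j ∧ ‖s.u‖ ^ 2 + 2 * s.eps ≤ p.sigma * ‖c - s.z + s.u‖ ^ 2

/-- Step 4: the final prox-gradient step, written as one `h`-resolvent, and the output. -/
def finalStep (p : AIPPParams) (ξ : ℝ) (y₀ : F) (x : E) : OracleProg E F (SchemeState E) :=
  evalSmoothed ξ y₀ x fun _ g =>
  .proxH (1 / p.Mlam) (x - p.Mlam⁻¹ • g) fun xbar =>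
  evalSmoothed ξ y₀ xbar fun _ gbar =>
  .done (.halted xbar (p.Mlam • (x - xbar) + gbar - g))

open Classical in
/-- One step of the AIPP-S program: one ACG iteration, followed by the tests of steps 1, 2, 3 and
possibly the computations of step 4. Step 3 restarts the last ACG call from its beginning, and all
of its iterations are counted again. -/
def schemeStep (p : AIPPParams) (ξ : ℝ) (y₀ : F) :
    SchemeState E → OracleProg E F (SchemeState E)
  | .step1 c s => acgIteration p ξ y₀ c s fun s' =>
      if s'.accept p c then
        if ‖c - s'.z + s'.u‖ ≤ p.lam * p.rhoHat / 5 then .done (.step3 c (ACGState.init c))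
        else .done (.step1 s'.z (ACGState.init s'.z))
      else .done (.step1 c s')
  | .step3 c s => acgIteration p ξ y₀ c s fun s' =>
      if s'.accept p c ∧ s'.eps ≤ p.epsHat * p.lam then finalStep p ξ y₀ s'.z
      else .done (.step3 c s')
  | .halted x u => .done (.halted x u)

/-- The state of the AIPP-S program after `n` steps and the number of elementary oracle evaluations
made so far. -/
def schemeExec (O : Oracle E F) (p : AIPPParams) (ξ : ℝ) (x₀ : E) (y₀ : F) :
    ℕ → SchemeState E × ℕ
  | 0 => (.step1 x₀ (ACGState.init x₀), 0)
  | n + 1 =>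
    let r := schemeExec O p ξ x₀ y₀ n
    let r' := (schemeStep p ξ y₀ r.1).run O
    (r'.1, r.2 + r'.2)

/-- With the oracle `O`, the AIPP-S program with the given inputs halts with output `(x, u)` after
exactly `q` elementary oracle evaluations. -/
def AIPPSHalts (O : Oracle E F) (m Lx Ly ξ : ℝ) (x₀ : E) (y₀ : F) (ρ : ℝ) (x u : E) (q : ℕ) :
    Prop :=
  ∃ n, schemeExec O (aippsParams m Lx Ly ξ ρ) ξ x₀ y₀ n = (.halted x u, q)

end Program

end

end MinMaxSmoothing

namespace MinMaxSmoothing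

open Filter Topology

/-! ### Proximal optimality conditions and the descent lemma. -/

section ConvexAnalysis

variable {Z : Type*} [NormedAddCommGroup Z] [InnerProductSpace ℝ Z]

/-! Subtracting the strongly convex term `‖y - y₀‖² / (2ξ)` inside the maximum replaces `p` by
`p_ξ`. This function is differentiable (Danskin), its gradient is `L_ξ`-Lipschitz because the
maximizer `y_ξ` is Lipschitz, its lower curvature constant is still `m`, and `p_ξ ≤ p ≤ p_ξ + D_y² /
(2ξ)`. So everything reduces to the AIPP method on `p_ξ + h`; the smoothing gap is the source of the
term `m D_y² / (ξ ρ²)`.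

For `λ = 1 / (4m)` each prox subproblem is strongly convex, and the ACG iterates satisfy `‖A u + z -
c‖² + 2 A ε ≤ ‖z - c‖²` with `A_j ≥ j² / (4L)` (`IsACG.residual`, `IsACG.sq_le_A`). From index `N`
on, `A ≥ 18`, so `u` and `ε` are small relative to `‖z - c‖` and every iterate passes the inexact
prox test (`AIPPSetting.proxIterate`). Hence each call of step 1 has exactly `N = O(Ω_ξ)`
iterations. A rejected outer step lowers `λ (p_ξ + h)` by a fixed multiple of `(λρ)²`, and the first
outer step can be compared with an arbitrary point of `X`; this bounds the number of outer steps in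
terms of `R` (`outer_count`). In step 3, `A_j` grows geometrically with ratio `1 + 1/s`, where `s =
√(2λM + 1)`, so `O(s log s)` further iterations bring `ε` below its threshold
(`exists_step3_index`).

For stationarity, strong convexity makes late iterates with the same center lie at comparable
distances from it, so the residual tested in step 2 also controls the iterate of step 3
(`residual_le`). The final prox-gradient step is then so short that `‖ū‖ ≤ ρ` (`refinement`). The
dual part is the optimality condition of `y_ξ`, with `‖v̄‖ ≤ D_y / ξ ≤ ρ_y`.

The cost is that of the oracle program, which is shown to reproduce a run of the method
(`isACG_programTrace`, `exists_halted`). -/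

lemma nonneg_of_forall_add_mul_nonneg {q K : ℝ} (h : ∀ t : ℝ, 0 < t → t < 1 → 0 ≤ q + t * K) :
    0 ≤ q := by
  have hlim : Tendsto (fun t : ℝ => q + t * K) (𝓝[>] 0) (𝓝 q) := by
    have : Tendsto (fun t : ℝ => q + t * K) (𝓝 0) (𝓝 (q + 0 * K)) :=
      (continuous_const.add (continuous_id.mul continuous_const)).tendsto 0
    simpa using this.mono_left nhdsWithin_le_nhds
  refine ge_of_tendsto hlim ?_
  filter_upwards [Ioo_mem_nhdsGT (zero_lt_one (α := ℝ))] with t ht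
  exact h t ht.1 ht.2

/-- The optimality condition for a proximal subproblem. -/
lemma IsArgmin.prox_subgradient {S : Set Z} {g : Z → ℝ} (hg : ConvexOn ℝ S g) {κ : ℝ} {c y : Z}
    (hy : IsArgmin S (fun v => g v + κ / 2 * ‖v - c‖ ^ 2) y) {v : Z} (hv : v ∈ S) :
    g y + κ * inner ℝ (c - y) (v - y) ≤ g v := by
  suffices 0 ≤ g v - g y - κ * inner ℝ (c - y) (v - y) by linarith
  -- Compare `y` with the point at parameter `t` of the segment to `v`: the extra quadratic term is
  -- of order `t²`, so dividing by `t` and letting `t → 0` leaves the claim.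
  refine nonneg_of_forall_add_mul_nonneg (K := κ / 2 * ‖v - y‖ ^ 2) fun t ht ht1 => ?_
  have hmem : (1 - t) • y + t • v ∈ S := hg.1 hy.1 hv (by linarith) ht.le (by ring)
  have h1 := hg.2 hy.1 hv (by linarith : 0 ≤ 1 - t) ht.le (by ring)
  have h2 : g y + κ / 2 * ‖y - c‖ ^ 2 ≤
      g ((1 - t) • y + t • v) + κ / 2 * ‖(1 - t) • y + t • v - c‖ ^ 2 := hy.2 hmem
  have h3 : ‖(1 - t) • y + t • v - c‖ ^ 2 =
      ‖y - c‖ ^ 2 - 2 * t * inner ℝ (c - y) (v - y) + t ^ 2 * ‖v - y‖ ^ 2 := by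
    have : (1 - t) • y + t • v - c = t • (v - y) - (c - y) := by module
    rw [this, norm_sub_sq_real, norm_smul, inner_smul_left, mul_pow, norm_sub_rev c y,
      real_inner_comm]
    simp
    ring
  simp only [smul_eq_mul] at h1
  rw [h3] at h2
  have : 0 ≤ t * (g v - g y - κ * inner ℝ (c - y) (v - y) + t * (κ / 2 * ‖v - y‖ ^ 2)) := by
    nlinarith
  exact nonneg_of_mul_nonneg_right this ht

lemma three_point (c y v : Z) :
    ‖v - c‖ ^ 2 = ‖y - c‖ ^ 2 - 2 * inner ℝ (c - y) (v - y) + ‖v - y‖ ^ 2 := by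
  have : v - c = (v - y) - (c - y) := by abel
  rw [this, norm_sub_sq_real, norm_sub_rev c y, real_inner_comm]
  ring

lemma convexOn_norm_sub_sq {S : Set Z} (hS : Convex ℝ S) (c : Z) :
    ConvexOn ℝ S (fun v => ‖v - c‖ ^ 2) := by
  refine ⟨hS, fun a _ b _ s t hs ht hst => ?_⟩
  have h : ‖s • (a - c) + t • (b - c)‖ ^ 2 =
      (s + t) * (s * ‖a - c‖ ^ 2 + t * ‖b - c‖ ^ 2) - s * t * ‖(a - c) - (b - c)‖ ^ 2 := by
    generalize a - c = p
    generalize b - c = q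
    rw [norm_add_sq_real, norm_sub_sq_real, norm_smul, norm_smul, inner_smul_left,
      inner_smul_right, mul_pow, mul_pow, Real.norm_eq_abs, Real.norm_eq_abs, sq_abs, sq_abs]
    simp
    ring
  have e : s • a + t • b - c = s • (a - c) + t • (b - c) := by
    obtain rfl : s = 1 - t := by linarith
    module
  simp only [e, h, hst, smul_eq_mul, one_mul]
  have : 0 ≤ s * t * ‖(a - c) - (b - c)‖ ^ 2 := by positivity
  linarith

lemma IsArgmin.prox_growth {S : Set Z} {g : Z → ℝ} (hg : ConvexOn ℝ S g) {κ : ℝ} {c y : Z}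
    (hy : IsArgmin S (fun v => g v + κ / 2 * ‖v - c‖ ^ 2) y) {v : Z} (hv : v ∈ S) :
    g y + κ / 2 * ‖y - c‖ ^ 2 + κ / 2 * ‖v - y‖ ^ 2 ≤ g v + κ / 2 * ‖v - c‖ ^ 2 := by
  have h := hy.prox_subgradient hg hv
  rw [three_point c y v]
  nlinarith

/-- The descent lemma for a function whose gradient is Lipschitz continuous on a convex set. -/
lemma descent_lemma [CompleteSpace Z] {S : Set Z} (hS : Convex ℝ S) {f : Z → ℝ} {G : Z → Z}
    {M : ℝ} (hf : ∀ x ∈ S, HasGradientAt f (G x) x)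
    (hG : ∀ x ∈ S, ∀ x' ∈ S, ‖G x - G x'‖ ≤ M * ‖x - x'‖) {x v : Z} (hx : x ∈ S) (hv : v ∈ S) :
    f v ≤ f x + inner ℝ (G x) (v - x) + M / 2 * ‖v - x‖ ^ 2 := by
  have hseg : ∀ t ∈ Set.Icc (0 : ℝ) 1, x + t • (v - x) ∈ S := fun t ht =>
    hS.add_smul_sub_mem hx hv ht
  let r : ℝ → ℝ := fun t =>
    f (x + t • (v - x)) - (t * inner ℝ (G x) (v - x) + M / 2 * ‖v - x‖ ^ 2 * t ^ 2)
  have hder : ∀ t ∈ Set.Icc (0 : ℝ) 1, HasDerivAt r (inner ℝ (G (x + t • (v - x))) (v - x) -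
      (1 * inner ℝ (G x) (v - x) + M / 2 * ‖v - x‖ ^ 2 * (2 * t))) t := by
    intro t ht
    have h1 : HasDerivAt (fun t : ℝ => x + t • (v - x)) (v - x) t := by
      simpa using ((hasDerivAt_id t).smul_const (v - x)).const_add x
    have h2 := (hf _ (hseg t ht)).hasFDerivAt.comp_hasDerivAt t h1
    have h3 : HasDerivAt (fun t : ℝ => t ^ 2) (2 * t) t := by simpa using hasDerivAt_pow 2 t
    have h4 := ((hasDerivAt_id t).mul_const (inner ℝ (G x) (v - x))).add
      (h3.const_mul (M / 2 * ‖v - x‖ ^ 2))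
    exact (show HasDerivAt r _ t from h2.sub h4).congr_deriv (by simp)
  have hanti : AntitoneOn r (Set.Icc 0 1) := by
    refine antitoneOn_of_deriv_nonpos (convex_Icc 0 1)
      (fun t ht => (hder t ht).continuousAt.continuousWithinAt)
      (fun t ht => (hder t (interior_subset ht)).differentiableAt.differentiableWithinAt) ?_
    intro t ht
    have ht' := interior_subset ht
    rw [(hder t ht').deriv]
    have h1 := hG _ (hseg t ht') x hx
    have h2 := real_inner_le_norm (G (x + t • (v - x)) - G x) (v - x)
    rw [add_sub_cancel_left, norm_smul, Real.norm_of_nonneg ht'.1] at h1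
    rw [inner_sub_left] at h2
    have h3 := mul_le_mul_of_nonneg_right h1 (norm_nonneg (v - x))
    nlinarith
  have := hanti (Set.left_mem_Icc.2 zero_le_one) (Set.right_mem_Icc.2 zero_le_one) zero_le_one
  simp [r] at this
  linarith

end ConvexAnalysis

end MinMaxSmoothing

namespace MinMaxSmoothing

/-! ### Convergence estimates for the accelerated composite gradient method. -/

section ACG

variable {E : Type*} [NormedAddCommGroup E] [InnerProductSpace ℝ E] [CompleteSpace E]

/-- A composite function `ψ_s + g + (μ / 2) ‖· - z₀‖²` on the convex set `X`, where `g` is convex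
and the linearization error of `ψ_s` at points of `X` is between `0` and `(L / 2) ‖·‖²`. -/
structure CompositeSetting (X : Set E) (ψs g : E → ℝ) (μ L : ℝ) (z₀ : E) : Prop where
  mu_pos : 0 < μ
  L_pos : 0 < L
  mem : z₀ ∈ X
  convexOn : ConvexOn ℝ X g
  lower : ∀ x ∈ X, ∀ v ∈ X, ψs x + inner ℝ (gradient ψs x) (v - x) ≤ ψs v
  upper : ∀ x ∈ X, ∀ v ∈ X,
    ψs v ≤ ψs x + inner ℝ (gradient ψs x) (v - x) + L / 2 * ‖v - x‖ ^ 2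

namespace IsACG

variable {X : Set E} {ψs ψn g : E → ℝ} {μ L : ℝ} {z₀ : E} {T : ACGTrace E}

lemma A_nonneg (hT : IsACG X ψs ψn μ L z₀ T) (hμ : 0 < μ) (hL : 0 < L) (j : ℕ) : 0 ≤ T.A j := by
  induction j with
  | zero => exact hT.A_zero.ge
  | succ j ih => rw [hT.A_succ]; positivity

lemma A_lt_succ (hT : IsACG X ψs ψn μ L z₀ T) (hμ : 0 < μ) (hL : 0 < L) (j : ℕ) :
    T.A j < T.A (j + 1) := by
  have := hT.A_nonneg hμ hL j
  rw [hT.A_succ, lt_add_iff_pos_right]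
  positivity

lemma A_succ_pos (hT : IsACG X ψs ψn μ L z₀ T) (hμ : 0 < μ) (hL : 0 < L) (j : ℕ) :
    0 < T.A (j + 1) :=
  (hT.A_nonneg hμ hL j).trans_lt (hT.A_lt_succ hμ hL j)

/-- `A_{j+1}` is the larger root of this quadratic equation. It is the balance needed in
`A_mul_le_model`. -/
lemma L_mul_sq_step (hT : IsACG X ψs ψn μ L z₀ T) (hμ : 0 < μ) (hL : 0 < L) (j : ℕ) :
    L * (T.A (j + 1) - T.A j) ^ 2 = (μ * T.A j + 1) * T.A (j + 1) := by
  have hA := hT.A_nonneg hμ hL j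
  have hs : √((μ * T.A j + 1) ^ 2 + 4 * L * (μ * T.A j + 1) * T.A j) ^ 2 =
      (μ * T.A j + 1) ^ 2 + 4 * L * (μ * T.A j + 1) * T.A j := Real.sq_sqrt (by positivity)
  rw [hT.A_succ]
  set s := √((μ * T.A j + 1) ^ 2 + 4 * L * (μ * T.A j + 1) * T.A j)
  field_simp
  linear_combination hs

/-- Geometric growth comes from the part `μ A_j` of the step equation, that is, from strong
convexity; the part `1` gives the quadratic growth of `sq_le_A`. -/
lemma mul_le_A_succ (hT : IsACG X ψs ψn μ L z₀ T) (hμ : 0 < μ) (hL : 0 < L) (j : ℕ) :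
    T.A j * (1 + √(μ / L)) ≤ T.A (j + 1) := by
  have hA := hT.A_nonneg hμ hL j
  have h0 := hT.A_lt_succ hμ hL j
  have h := hT.L_mul_sq_step hμ hL j
  have h1 : (√(μ / L) * T.A j) ^ 2 ≤ (T.A (j + 1) - T.A j) ^ 2 := by
    rw [mul_pow, Real.sq_sqrt (by positivity), div_mul_eq_mul_div, div_le_iff₀ hL,
      mul_comm _ L, h]
    nlinarith [mul_nonneg hμ.le hA]
  have := abs_le_of_sq_le_sq' h1 (sub_pos.2 h0).le
  linarith [this.2]

/-- The quantity `s_j = √(4 L A_j)` grows by at least one per iteration: the step equation gives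
`s_{j+1} ≤ 2 L (A_{j+1} - A_j)`, hence `s_j² ≤ s_{j+1}² - 2 s_{j+1} ≤ (s_{j+1} - 1)²`. -/
lemma sq_le_A (hT : IsACG X ψs ψn μ L z₀ T) (hμ : 0 < μ) (hL : 0 < L) (j : ℕ) :
    (j : ℝ) ^ 2 ≤ 4 * L * T.A j := by
  induction j with
  | zero => simp [hT.A_zero]
  | succ j ih =>
    have hA := hT.A_nonneg hμ hL j
    have hA' := hT.A_succ_pos hμ hL j
    have hlt := hT.A_lt_succ hμ hL j
    have h := hT.L_mul_sq_step hμ hL j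
    obtain ⟨s, hs, hs2⟩ : ∃ s, 0 < s ∧ s ^ 2 = 4 * L * T.A (j + 1) :=
      ⟨√(4 * L * T.A (j + 1)), by positivity, Real.sq_sqrt (by positivity)⟩
    have h1 : s ≤ 2 * L * (T.A (j + 1) - T.A j) := by
      refine (abs_le_of_sq_le_sq' ?_ (by nlinarith)).2
      rw [hs2]
      nlinarith [mul_nonneg (mul_nonneg hμ.le hA) hA'.le]
    have h2 : 2 * s ≤ s ^ 2 := by nlinarith
    have h3 : (j : ℝ) ≤ s - 1 := by
      refine (abs_le_of_sq_le_sq' ?_ (by nlinarith)).2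
      nlinarith
    push_cast
    rw [← hs2]
    exact pow_le_pow_left₀ (by positivity) (by linarith) 2

lemma y_mem (hT : IsACG X ψs ψn μ L z₀ T) (hz : z₀ ∈ X) (j : ℕ) : T.y j ∈ X := by
  cases j with
  | zero => rwa [hT.y_zero]
  | succ j => exact (hT.y_succ j).1

lemma combo_mem (hT : IsACG X ψs ψn μ L z₀ T) (hμ : 0 < μ) (hL : 0 < L) (hX : Convex ℝ X)
    (j : ℕ) {a b : E} (ha : a ∈ X) (hb : b ∈ X) :
    (T.A j / T.A (j + 1)) • a + ((T.A (j + 1) - T.A j) / T.A (j + 1)) • b ∈ X := by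
  have h1 := hT.A_nonneg hμ hL j
  have h2 := hT.A_lt_succ hμ hL j
  have h3 := hT.A_succ_pos hμ hL j
  exact hX ha hb (by positivity) (div_nonneg (sub_nonneg.2 h2.le) h3.le) (by field_simp; ring)

lemma z_mem (hT : IsACG X ψs ψn μ L z₀ T) (hμ : 0 < μ) (hL : 0 < L) (hX : Convex ℝ X)
    (hz : z₀ ∈ X) (j : ℕ) : T.z j ∈ X := by
  induction j with
  | zero => rwa [hT.z_zero]
  | succ j ih => rw [hT.z_succ]; exact hT.combo_mem hμ hL hX j ih (hT.y_mem hz _)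

lemma ztil_mem (hT : IsACG X ψs ψn μ L z₀ T) (hμ : 0 < μ) (hL : 0 < L) (hX : Convex ℝ X)
    (hz : z₀ ∈ X) (j : ℕ) : T.ztil j ∈ X := by
  rw [hT.ztil_eq]
  exact hT.combo_mem hμ hL hX j (hT.z_mem hμ hL hX hz j) (hT.y_mem hz j)

lemma Gam_affine (hT : IsACG X ψs ψn μ L z₀ T) (j : ℕ) :
    ∃ (α : ℝ) (β : E), ∀ v, T.Gam j v = α + inner ℝ β v := by
  induction j with
  | zero => exact ⟨0, 0, fun v => by simp [hT.Gam_zero]⟩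
  | succ j ih =>
    obtain ⟨α, β, h⟩ := ih
    refine ⟨T.A j / T.A (j + 1) * α + (T.A (j + 1) - T.A j) / T.A (j + 1) *
      (ψs (T.ztil j) - inner ℝ (gradient ψs (T.ztil j)) (T.ztil j)),
      (T.A j / T.A (j + 1)) • β +
        ((T.A (j + 1) - T.A j) / T.A (j + 1)) • gradient ψs (T.ztil j), fun v => ?_⟩
    rw [hT.Gam_succ, h, inner_add_left, inner_smul_left, inner_smul_left, inner_sub_right]
    simp
    ring

lemma A_mul_Gam_succ (hT : IsACG X ψs ψn μ L z₀ T) (hμ : 0 < μ) (hL : 0 < L) (j : ℕ) (v : E) :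
    T.A (j + 1) * T.Gam (j + 1) v = T.A j * T.Gam j v + (T.A (j + 1) - T.A j) *
      (ψs (T.ztil j) + inner ℝ (gradient ψs (T.ztil j)) (v - T.ztil j)) := by
  have := hT.A_succ_pos hμ hL j
  rw [hT.Gam_succ]
  field_simp

variable (hS : CompositeSetting X ψs g μ L z₀)
  (hT : IsACG X ψs (fun v => g v + μ / 2 * ‖v - z₀‖ ^ 2) μ L z₀ T)

include hS hT

/-- The factor `A_j` lets the induction start: `Γ_0 = 0` need not lie below `ψs`, but `A_0 = 0`. -/
lemma A_mul_Gam_le (j : ℕ) {v : E} (hv : v ∈ X) : T.A j * T.Gam j v ≤ T.A j * ψs v := by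
  induction j with
  | zero => simp [hT.A_zero]
  | succ j ih =>
    rw [hT.A_mul_Gam_succ hS.mu_pos hS.L_pos]
    have h1 := hS.lower _ (hT.ztil_mem hS.mu_pos hS.L_pos hS.convexOn.1 hS.mem j) v hv
    have h2 := hT.A_lt_succ hS.mu_pos hS.L_pos j
    nlinarith

lemma Gam_succ_le (j : ℕ) {v : E} (hv : v ∈ X) : T.Gam (j + 1) v ≤ ψs v :=
  le_of_mul_le_mul_left (hT.A_mul_Gam_le hS (j + 1) hv) (hT.A_succ_pos hS.mu_pos hS.L_pos j)

/-- `y_j` minimizes the `(μ A_j + 1)`-strongly convex function on the right. Multiplying by `A_j`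
makes the case `j = 0` meaningful. -/
lemma model_growth (j : ℕ) {v : E} (hv : v ∈ X) :
    T.A j * (T.Gam j (T.y j) + (g (T.y j) + μ / 2 * ‖T.y j - z₀‖ ^ 2)) +
        1 / 2 * ‖T.y j - z₀‖ ^ 2 + (μ * T.A j + 1) / 2 * ‖v - T.y j‖ ^ 2 ≤
      T.A j * (T.Gam j v + (g v + μ / 2 * ‖v - z₀‖ ^ 2)) + 1 / 2 * ‖v - z₀‖ ^ 2 := by
  cases j with
  | zero => simp [hT.A_zero, hT.y_zero]
  | succ j =>
    have hA := hT.A_succ_pos hS.mu_pos hS.L_pos j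
    have hy := hT.y_succ j
    rw [hT.y_zero] at hy
    obtain ⟨α, β, hΓ⟩ := hT.Gam_affine (j + 1)
    have hconv : ConvexOn ℝ X (fun v => T.Gam (j + 1) v + g v) := by
      refine ConvexOn.add ⟨hS.convexOn.1, fun a _ b _ s t _ _ hst => ?_⟩ hS.convexOn
      simp only [hΓ, inner_add_right, inner_smul_right, smul_eq_mul]
      apply le_of_eq
      linear_combination (-α) * hst
    have hy' : IsArgmin X (fun v => (T.Gam (j + 1) v + g v) +
        (μ + 1 / T.A (j + 1)) / 2 * ‖v - z₀‖ ^ 2) (T.y (j + 1)) := by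
      convert hy using 2 with v
      field_simp
      ring
    have h := hy'.prox_growth hconv hv
    have h' := mul_le_mul_of_nonneg_left h hA.le
    have e : T.A (j + 1) * (1 / T.A (j + 1)) = 1 := by field_simp
    set q := 1 / T.A (j + 1)
    set a := T.A (j + 1)
    have e2 : ∀ r : ℝ, a * ((μ + q) / 2 * r) = (μ * a + 1) / 2 * r := fun r => by
      linear_combination (r / 2) * e
    simp only [mul_add, e2] at h'
    linarith

/-- The fundamental estimate of the ACG method. -/
lemma A_mul_le_model (j : ℕ) :
    T.A j * (ψs (T.z j) + (g (T.z j) + μ / 2 * ‖T.z j - z₀‖ ^ 2)) ≤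
      T.A j * (T.Gam j (T.y j) + (g (T.y j) + μ / 2 * ‖T.y j - z₀‖ ^ 2)) +
        1 / 2 * ‖T.y j - z₀‖ ^ 2 := by
  induction j with
  | zero => simp [hT.A_zero]
  | succ j ih =>
    have hX := hS.convexOn.1
    have hA := hT.A_nonneg hS.mu_pos hS.L_pos j
    have hAA := hT.A_lt_succ hS.mu_pos hS.L_pos j
    have hA' := hT.A_succ_pos hS.mu_pos hS.L_pos j
    have hstep := hT.L_mul_sq_step hS.mu_pos hS.L_pos j
    have hy' := hT.y_mem hS.mem (j + 1)
    have hz := hT.z_mem hS.mu_pos hS.L_pos hX hS.mem j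
    have hz' := hT.z_mem hS.mu_pos hS.L_pos hX hS.mem (j + 1)
    have hzt := hT.ztil_mem hS.mu_pos hS.L_pos hX hS.mem j
    have hgrow := hT.model_growth hS j hy'
    have hlow := hS.lower _ hzt _ hz
    have hup := hS.upper _ hzt _ hz'
    have hG := hT.A_mul_Gam_succ hS.mu_pos hS.L_pos j (T.y (j + 1))
    set A := T.A j
    set A' := T.A (j + 1)
    set a := A' - A with ha
    set y := T.y j
    set y' := T.y (j + 1)
    set w := T.ztil j
    set z := T.z j
    set z' := T.z (j + 1) with hz'_def
    have ha0 : 0 < a := sub_pos.2 hAA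
    have hψn : ConvexOn ℝ X (fun v => g v + μ / 2 * ‖v - z₀‖ ^ 2) :=
      hS.convexOn.add ((convexOn_norm_sub_sq hX z₀).smul (half_pos hS.mu_pos).le)
    have hzc : z' = (A / A') • z + (a / A') • y' := hT.z_succ j
    have hconv := hψn.2 hz hy' (show 0 ≤ A / A' by positivity) (show 0 ≤ a / A' by positivity)
      (by rw [ha]; field_simp; ring)
    rw [← hzc] at hconv
    simp only [smul_eq_mul] at hconv
    have hconv' : A' * (g z' + μ / 2 * ‖z' - z₀‖ ^ 2) ≤
        A * (g z + μ / 2 * ‖z - z₀‖ ^ 2) + a * (g y' + μ / 2 * ‖y' - z₀‖ ^ 2) := by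
      refine (mul_le_mul_of_nonneg_left hconv hA'.le).trans_eq ?_
      field_simp
    have hlin : A' * inner ℝ (gradient ψs w) (z' - w) =
        A * inner ℝ (gradient ψs w) (z - w) + a * inner ℝ (gradient ψs w) (y' - w) := by
      rw [hzc, ← inner_smul_right, ← inner_smul_right, ← inner_smul_right, ← inner_add_right]
      congr 1
      have e1 : A' * (A / A') = A := by field_simp
      have e2 : A' * (a / A') = a := by field_simp
      rw [smul_sub, smul_add, smul_smul, smul_smul, e1, e2, show A' = A + a by rw [ha]; ring]
      module
    have hdist : ‖z' - w‖ ^ 2 = (a / A') ^ 2 * ‖y' - y‖ ^ 2 := by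
      have : z' - w = (a / A') • (y' - y) := by
        rw [hzc, show w = (A / A') • z + (a / A') • y from hT.ztil_eq j]
        module
      rw [this, norm_smul, mul_pow, Real.norm_eq_abs, sq_abs]
    -- By the step equation, the error of the upper quadratic bound at `z'` equals the growth term
    -- of the model at `y'`, so the two cancel.
    have hquad : A' * (L / 2 * ‖z' - w‖ ^ 2) = (μ * A + 1) / 2 * ‖y' - y‖ ^ 2 := by
      rw [hdist]
      have : A' * (L / 2 * ((a / A') ^ 2 * ‖y' - y‖ ^ 2)) =
          (L * a ^ 2) / (2 * A') * ‖y' - y‖ ^ 2 := by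
        field_simp
      rw [this, hstep]
      field_simp
    have h1 := mul_le_mul_of_nonneg_left hup hA'.le
    have h2 := mul_le_mul_of_nonneg_left hlow hA
    simp only [mul_add] at h1 h2 hG hgrow ih ⊢ hconv' hquad
    have h3 : A' * ψs w = A * ψs w + a * ψs w := by rw [ha]; ring
    have h4 : A' * g y' = A * g y' + a * g y' := by rw [ha]; ring
    have h5 : A' * (μ / 2 * ‖y' - z₀‖ ^ 2) =
      A * (μ / 2 * ‖y' - z₀‖ ^ 2) + a * (μ / 2 * ‖y' - z₀‖ ^ 2) := by rw [ha]; ring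
    linarith

lemma model_subgradient (j : ℕ) {v : E} (hv : v ∈ X) :
    T.Gam (j + 1) (T.y (j + 1)) + (g (T.y (j + 1)) + μ / 2 * ‖T.y (j + 1) - z₀‖ ^ 2) +
        inner ℝ (T.u (j + 1)) (v - T.y (j + 1)) ≤
      T.Gam (j + 1) v + (g v + μ / 2 * ‖v - z₀‖ ^ 2) := by
  have hA := hT.A_succ_pos hS.mu_pos hS.L_pos j
  have h := hT.model_growth hS (j + 1) hv
  rw [hT.u_succ, hT.y_zero, inner_smul_left]
  refine le_of_mul_le_mul_left ?_ hA
  have e : T.A (j + 1) * ((starRingEnd ℝ) (1 / T.A (j + 1)) *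
      inner ℝ (z₀ - T.y (j + 1)) (v - T.y (j + 1))) =
      inner ℝ (z₀ - T.y (j + 1)) (v - T.y (j + 1)) := by
    simp
    field_simp
  rw [mul_add, e]
  have h3 := three_point z₀ (T.y (j + 1)) v
  have h4 : 0 ≤ μ * T.A (j + 1) * ‖v - T.y (j + 1)‖ ^ 2 := by
    have := hS.mu_pos
    positivity
  nlinarith

/-- `u` is an exact subgradient at `y` of the model, which lies below the objective on `X`; `ε` is
the gap created by moving the base point from `y` to `z`. -/
lemma subgradient (j : ℕ) {v : E} (hv : v ∈ X) :
    ψs (T.z (j + 1)) + (g (T.z (j + 1)) + μ / 2 * ‖T.z (j + 1) - z₀‖ ^ 2) +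
        inner ℝ (T.u (j + 1)) (v - T.z (j + 1)) - T.eps (j + 1) ≤
      ψs v + (g v + μ / 2 * ‖v - z₀‖ ^ 2) := by
  have h1 := hT.model_subgradient hS j hv
  have h2 := hT.Gam_succ_le hS j hv
  have h3 : inner ℝ (T.u (j + 1)) (v - T.y (j + 1)) = inner ℝ (T.u (j + 1)) (v - T.z (j + 1)) +
      inner ℝ (T.u (j + 1)) (T.z (j + 1) - T.y (j + 1)) := by
    rw [← inner_add_right, sub_add_sub_cancel]
  rw [hT.eps_succ]
  linarith

lemma eps_nonneg (j : ℕ) : 0 ≤ T.eps (j + 1) := by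
  have := hT.subgradient hS j (hT.z_mem hS.mu_pos hS.L_pos hS.convexOn.1 hS.mem (j + 1))
  rw [sub_self, inner_zero_right] at this
  linarith

/-- Since `A u = z₀ - y`, the first vector is `z - y`, and the claim is the fundamental estimate
rewritten with `three_point`. It bounds `u` and `ε` at once in terms of `‖z - z₀‖`. -/
lemma residual (j : ℕ) :
    ‖T.A (j + 1) • T.u (j + 1) + (T.z (j + 1) - z₀)‖ ^ 2 + 2 * T.A (j + 1) * T.eps (j + 1) ≤
      ‖T.z (j + 1) - z₀‖ ^ 2 := by
  have hA := hT.A_succ_pos hS.mu_pos hS.L_pos j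
  have h := hT.A_mul_le_model hS (j + 1)
  have hu : T.A (j + 1) • T.u (j + 1) = z₀ - T.y (j + 1) := by
    rw [hT.u_succ, hT.y_zero, smul_smul, mul_one_div_cancel hA.ne', one_smul]
  have hi : T.A (j + 1) * inner ℝ (T.u (j + 1)) (T.z (j + 1) - T.y (j + 1)) =
      inner ℝ (z₀ - T.y (j + 1)) (T.z (j + 1) - T.y (j + 1)) := by
    rw [← hu, inner_smul_left]
    simp
  have h3 := three_point z₀ (T.y (j + 1)) (T.z (j + 1))
  rw [hu, hT.eps_succ, show z₀ - T.y (j + 1) + (T.z (j + 1) - z₀) = T.z (j + 1) - T.y (j + 1) by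
    abel]
  linarith

end IsACG

end ACG

end MinMaxSmoothing

namespace MinMaxSmoothing

/-! ### Late ACG iterates as inexact proximal points. -/

section InexactProx

lemma AIPPParams.nonsmoothPart_eq {E : Type*} [NormedAddCommGroup E] (p : AIPPParams)
    (h : E → ℝ) (c : E) :
    (fun v => p.lam * h v + 1 / 4 * ‖v - c‖ ^ 2) =
      fun v => p.lam * h v + p.acgMu / 2 * ‖v - c‖ ^ 2 := by
  ext v; norm_num [AIPPParams.acgMu]

variable {E : Type*} [NormedAddCommGroup E] [InnerProductSpace ℝ E]

/-- What the analysis uses of a late iterate `(x, u, ε)` of the ACG call with prox center `c`. -/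
structure ProxIterate (X : Set E) (φ : E → ℝ) (p : AIPPParams) (c x u : E) (ε : ℝ) : Prop where
  mem : x ∈ X
  eps_nonneg : 0 ≤ ε
  subgradient : ∀ v ∈ X, p.lam * φ x + 1 / 2 * ‖x - c‖ ^ 2 + inner ℝ u (v - x) - ε ≤
    p.lam * φ v + 1 / 2 * ‖v - c‖ ^ 2
  norm_u_le : ‖u‖ ≤ ‖x - c‖ / 9
  eps_le : ε ≤ ‖x - c‖ ^ 2 / 36

namespace ProxIterate

variable {X : Set E} {φ : E → ℝ} {p : AIPPParams} {c x u : E} {ε : ℝ}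

lemma norm_residual_ge (hi : ProxIterate X φ p c x u ε) : 8 / 9 * ‖x - c‖ ≤ ‖c - x + u‖ := by
  have h := norm_sub_norm_le (c - x) (-u)
  rw [sub_neg_eq_add, norm_neg, norm_sub_rev c x] at h
  linarith [hi.norm_u_le]

lemma norm_residual_le (hi : ProxIterate X φ p c x u ε) : ‖c - x + u‖ ≤ 10 / 9 * ‖x - c‖ := by
  have h := norm_add_le (c - x) u
  rw [norm_sub_rev c x] at h
  linarith [hi.norm_u_le]

/-- In units of `‖x - c‖²`, the left side is at most `1/81 + 2/36 = 11/162`, the right side at least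
`(1/2)(8/9)² = 64/162`. -/
lemma relative_error (hi : ProxIterate X φ p c x u ε) :
    ‖u‖ ^ 2 + 2 * ε ≤ 1 / 2 * ‖c - x + u‖ ^ 2 := by
  have h1 := pow_le_pow_left₀ (by positivity) hi.norm_residual_ge 2
  have h2 := pow_le_pow_left₀ (norm_nonneg _) hi.norm_u_le 2
  have h3 := hi.eps_le
  nlinarith [sq_nonneg ‖x - c‖]

lemma inexactProx (hi : ProxIterate X φ p c x u ε) (hσ : p.sigma = 1 / 2) :
    InexactProx X φ p c x u ε :=
  ⟨hi.eps_nonneg, ⟨hi.mem, hi.subgradient⟩, by rw [hσ]; exact hi.relative_error⟩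

/-- The objective decreases from the prox center to the iterate. -/
lemma descent (hi : ProxIterate X φ p c x u ε) (hc : c ∈ X) :
    p.lam * φ x + 1 / 4 * ‖c - x + u‖ ^ 2 ≤ p.lam * φ c := by
  have h1 := hi.subgradient c hc
  have h2 := hi.relative_error
  -- Half of this square gathers the quadratic and linear terms of the subgradient inequality; the
  -- relative error consumes `1/4` of the coefficient `1/2`.
  have h3 := norm_add_sq_real (c - x) u
  rw [sub_self, norm_zero] at h1
  rw [norm_sub_rev c x, real_inner_comm] at h3
  linarith

/-- Compares the iterate with an arbitrary point instead of the center, which is what makes `R`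
appear in the complexity. The constant is `1/2 + 1/18`, from `‖x - c‖ ‖v - c‖ / 9 ≤ (‖x - c‖² + ‖v -
c‖²) / 18`. -/
lemma le_add_dist_sq (hi : ProxIterate X φ p c x u ε) {v : E} (hv : v ∈ X) :
    p.lam * φ x ≤ p.lam * φ v + 5 / 9 * ‖v - c‖ ^ 2 := by
  have h1 := hi.subgradient v hv
  have h2 := abs_le.1 (abs_real_inner_le_norm u (v - x))
  have h3 : ‖v - x‖ ≤ ‖v - c‖ + ‖x - c‖ := by
    rw [norm_sub_rev x c]
    exact norm_sub_le_norm_sub_add_norm_sub _ _ _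
  have h4 := mul_le_mul hi.norm_u_le h3 (norm_nonneg _) (by positivity)
  nlinarith [hi.eps_le, sq_nonneg (‖x - c‖ - ‖v - c‖), sq_nonneg ‖x - c‖]

end ProxIterate

variable [CompleteSpace E]

/-- The standing assumptions on the problem `min f + h` to which the AIPP method is applied, with
the stepsize `λ = 1 / (4 m)` and the relative error `σ = 1 / 2`. -/
structure AIPPSetting (X : Set E) (f h : E → ℝ) (p : AIPPParams) (m : ℝ) : Prop where
  m_pos : 0 < m
  m_le : m ≤ p.M
  lam_eq : p.lam = 1 / (4 * m)
  sigma_eq : p.sigma = 1 / 2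
  rho_pos : 0 < p.rho
  convexOn : ConvexOn ℝ X h
  hasGradientAt : ∀ x ∈ X, HasGradientAt f (gradient f x) x
  lower : ∀ x ∈ X, ∀ v ∈ X, f x + inner ℝ (gradient f x) (v - x) - m / 2 * ‖v - x‖ ^ 2 ≤ f v
  lipschitz : ∀ x ∈ X, ∀ v ∈ X, ‖gradient f x - gradient f v‖ ≤ p.M * ‖x - v‖

namespace AIPPSetting

variable {X : Set E} {f h : E → ℝ} {p : AIPPParams} {m : ℝ}

lemma lam_pos (hS : AIPPSetting X f h p m) : 0 < p.lam := by
  have := hS.m_pos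
  rw [hS.lam_eq]; positivity

lemma lam_mul_m (hS : AIPPSetting X f h p m) : p.lam * m = 1 / 4 := by
  have := hS.m_pos
  rw [hS.lam_eq]; field_simp

lemma M_pos (hS : AIPPSetting X f h p m) : 0 < p.M := hS.m_pos.trans_le hS.m_le

lemma lam_mul_M_pos (hS : AIPPSetting X f h p m) : 0 < p.lam * p.M := mul_pos hS.lam_pos hS.M_pos

lemma acgL_pos (hS : AIPPSetting X f h p m) : 0 < p.acgL := by
  have := hS.lam_mul_M_pos
  unfold AIPPParams.acgL
  positivity

lemma upper (hS : AIPPSetting X f h p m) {x v : E} (hx : x ∈ X) (hv : v ∈ X) :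
    f v ≤ f x + inner ℝ (gradient f x) (v - x) + p.M / 2 * ‖v - x‖ ^ 2 :=
  descent_lemma hS.convexOn.1 hS.hasGradientAt hS.lipschitz hx hv

lemma gradient_smoothPart (hS : AIPPSetting X f h p m) (c : E) {x : E} (hx : x ∈ X) :
    gradient (fun v => p.lam * f v + 1 / 4 * ‖v - c‖ ^ 2) x =
      p.lam • gradient f x + (1 / 2 : ℝ) • (x - c) := by
  apply HasGradientAt.gradient
  rw [hasGradientAt_iff_hasFDerivAt]
  have h1 := (hS.hasGradientAt x hx).hasFDerivAt.const_mul p.lam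
  have h2 := (((hasFDerivAt_id x).sub_const c).norm_sq).const_mul (1 / 4 : ℝ)
  refine (h1.add h2).congr_fderiv ?_
  ext v
  simp
  ring

/-- As `λ m = 1/4`, the function `λ f` lacks at most `‖·‖² / 8` of convexity, and `‖· - c‖² / 4`
more than repairs it. The other `‖· - c‖² / 4` sits in the nonsmooth part and supplies `μ = 1/2`. -/
lemma compositeSetting (hS : AIPPSetting X f h p m) {c : E} (hc : c ∈ X) :
    CompositeSetting X (fun v => p.lam * f v + 1 / 4 * ‖v - c‖ ^ 2) (fun v => p.lam * h v)
      p.acgMu p.acgL c where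
  mu_pos := by norm_num [AIPPParams.acgMu]
  L_pos := hS.acgL_pos
  mem := hc
  convexOn := hS.convexOn.smul hS.lam_pos.le
  lower := fun x hx v hv => by
    rw [hS.gradient_smoothPart c hx, inner_add_left, inner_smul_left, inner_smul_left]
    have h1 := mul_le_mul_of_nonneg_left (hS.lower x hx v hv) hS.lam_pos.le
    have h2 := three_point c x v
    have h3 : inner ℝ (x - c) (v - x) = - inner ℝ (c - x) (v - x) := by
      rw [← inner_neg_left, neg_sub]
    have h4 : p.lam * (m / 2 * ‖v - x‖ ^ 2) = 1 / 8 * ‖v - x‖ ^ 2 := by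
      linear_combination (‖v - x‖ ^ 2 / 2) * hS.lam_mul_m
    simp only [h3, conj_trivial]
    nlinarith [sq_nonneg ‖v - x‖]
  upper := fun x hx v hv => by
    rw [hS.gradient_smoothPart c hx, inner_add_left, inner_smul_left, inner_smul_left]
    have h1 := mul_le_mul_of_nonneg_left (hS.upper hx hv) hS.lam_pos.le
    have h2 := three_point c x v
    have h3 : inner ℝ (x - c) (v - x) = - inner ℝ (c - x) (v - x) := by
      rw [← inner_neg_left, neg_sub]
    simp only [h3, conj_trivial, AIPPParams.acgL]
    nlinarith [sq_nonneg ‖v - x‖]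

section Call

variable {c : E} {T : ACGTrace E}
  (hS : AIPPSetting X f h p m) (hc : c ∈ X)
  (hT : IsACG X (fun v => p.lam * f v + 1 / 4 * ‖v - c‖ ^ 2)
    (fun v => p.lam * h v + 1 / 4 * ‖v - c‖ ^ 2) p.acgMu p.acgL c T)

include hS in
lemma minIter_pos : 0 < p.minIter := by
  have := hS.lam_mul_M_pos
  rw [AIPPParams.minIter, Nat.ceil_pos, mul_assoc]
  positivity

include hS hT in
-- Since `4 L = 2 (2λM + 1)` and `j² ≥ 36 (2λM + 1)`, the bound `A_j ≥ j² / (4L)` yields `18`.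
lemma eighteen_le_A {j : ℕ} (hj : p.minIter ≤ j) : 18 ≤ T.A j := by
  have hL := hS.lam_mul_M_pos
  have h1 := hT.sq_le_A (by norm_num [AIPPParams.acgMu]) hS.acgL_pos j
  have h2 : 6 * √(2 * p.lam * p.M + 1) ≤ j := (Nat.le_ceil _).trans (by exact_mod_cast hj)
  have h3 := pow_le_pow_left₀ (by positivity) h2 2
  rw [mul_pow, Real.sq_sqrt (by rw [mul_assoc]; positivity)] at h3
  unfold AIPPParams.acgL at h1
  by_contra! hlt
  nlinarith

include hS hc hT in
lemma subgradient_acg (j : ℕ) : T.z (j + 1) ∈ X ∧ 0 ≤ T.eps (j + 1) ∧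
    (∀ v ∈ X, p.lam * (f (T.z (j + 1)) + h (T.z (j + 1))) + 1 / 2 * ‖T.z (j + 1) - c‖ ^ 2 +
      inner ℝ (T.u (j + 1)) (v - T.z (j + 1)) - T.eps (j + 1) ≤
      p.lam * (f v + h v) + 1 / 2 * ‖v - c‖ ^ 2) ∧
    ‖T.A (j + 1) • T.u (j + 1) + (T.z (j + 1) - c)‖ ^ 2 + 2 * T.A (j + 1) * T.eps (j + 1) ≤
      ‖T.z (j + 1) - c‖ ^ 2 := by
  have hC := hS.compositeSetting hc
  rw [p.nonsmoothPart_eq h] at hT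
  refine ⟨hT.z_mem hC.mu_pos hC.L_pos hC.convexOn.1 hc _, hT.eps_nonneg hC j, fun v hv => ?_,
    hT.residual hC j⟩
  have := hT.subgradient hC j hv
  norm_num [AIPPParams.acgMu] at this ⊢
  linarith

include hS hc hT in
lemma eps_le_div {j : ℕ} (hj : p.minIter ≤ j) : T.eps j ≤ ‖T.z j - c‖ ^ 2 / (2 * T.A j) := by
  have hA := hS.eighteen_le_A hT hj
  obtain ⟨i, rfl⟩ := Nat.exists_eq_add_of_lt (hS.minIter_pos.trans_le hj)
  rw [zero_add] at *
  obtain ⟨-, -, -, h3⟩ := hS.subgradient_acg hc hT i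
  rw [le_div_iff₀ (by positivity)]
  nlinarith [sq_nonneg ‖T.A (i + 1) • T.u (i + 1) + (T.z (i + 1) - c)‖]

include hS hc hT in
-- `IsACG.residual` gives `A ‖u‖ ≤ 2 ‖z - c‖` and `2 A ε ≤ ‖z - c‖²`; insert `A ≥ 18`. Consequently
-- no iterate of index at least `minIter` can fail the prox test.
lemma proxIterate {j : ℕ} (hj : p.minIter ≤ j) :
    ProxIterate X (fun v => f v + h v) p c (T.z j) (T.u j) (T.eps j) := by
  have hA := hS.eighteen_le_A hT hj
  have hε := hS.eps_le_div hc hT hj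
  obtain ⟨i, rfl⟩ := Nat.exists_eq_add_of_lt (hS.minIter_pos.trans_le hj)
  rw [zero_add] at *
  obtain ⟨h0, h1, h2, h3⟩ := hS.subgradient_acg hc hT i
  refine ⟨h0, h1, h2, ?_, hε.trans ?_⟩
  · have h4 : ‖T.A (i + 1) • T.u (i + 1) + (T.z (i + 1) - c)‖ ≤ ‖T.z (i + 1) - c‖ := by
      refine (abs_le_of_sq_le_sq' ?_ (norm_nonneg _)).2
      nlinarith
    have h5 := norm_sub_norm_le (T.A (i + 1) • T.u (i + 1)) (-(T.z (i + 1) - c))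
    rw [sub_neg_eq_add, norm_neg, norm_smul, Real.norm_of_nonneg (by linarith)] at h5
    nlinarith [norm_nonneg (T.u (i + 1))]
  · gcongr
    linarith

include hS hT in
lemma pow_le_A {j : ℕ} (hj : p.minIter ≤ j) (i : ℕ) :
    (1 + 1 / √(2 * p.lam * p.M + 1)) ^ i ≤ T.A (j + i) := by
  have hL := hS.lam_mul_M_pos
  have hq : √(p.acgMu / p.acgL) = 1 / √(2 * p.lam * p.M + 1) := by
    rw [← Real.sqrt_one, ← Real.sqrt_div zero_le_one, Real.sqrt_one]
    unfold AIPPParams.acgMu AIPPParams.acgL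
    congr 1
    have : 0 < 2 * p.lam * p.M + 1 := by rw [mul_assoc]; positivity
    field_simp
  induction i with
  | zero => simpa using (by norm_num : (1 : ℝ) ≤ 18).trans (hS.eighteen_le_A hT hj)
  | succ i ih =>
    rw [pow_succ]
    have := hT.mul_le_A_succ (by norm_num [AIPPParams.acgMu]) hS.acgL_pos (j + i)
    rw [hq] at this
    exact (mul_le_mul_of_nonneg_right ih (by positivity)).trans this

end Call

section Pair

variable {c x u x' u' : E} {ε ε' : ℝ} (hS : AIPPSetting X f h p m)

include hS in
-- The prox objective has strong convexity modulus at least `1 - λ m = 3/4`, and the gain at a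
-- midpoint is an eighth of the modulus.
lemma midpoint_le {a b : E} (ha : a ∈ X) (hb : b ∈ X) (c : E) :
    p.lam * (f ((1 / 2 : ℝ) • a + (1 / 2 : ℝ) • b) + h ((1 / 2 : ℝ) • a + (1 / 2 : ℝ) • b)) +
        1 / 2 * ‖(1 / 2 : ℝ) • a + (1 / 2 : ℝ) • b - c‖ ^ 2 + 3 / 32 * ‖b - a‖ ^ 2 ≤
      1 / 2 * (p.lam * (f a + h a) + 1 / 2 * ‖a - c‖ ^ 2) +
        1 / 2 * (p.lam * (f b + h b) + 1 / 2 * ‖b - c‖ ^ 2) := by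
  have hw : (1 / 2 : ℝ) • a + (1 / 2 : ℝ) • b ∈ X :=
    hS.convexOn.1 ha hb (by norm_num) (by norm_num) (by norm_num)
  have hh := hS.convexOn.2 ha hb (by norm_num : (0 : ℝ) ≤ 1 / 2) (by norm_num : (0 : ℝ) ≤ 1 / 2)
    (by norm_num)
  set w := (1 / 2 : ℝ) • a + (1 / 2 : ℝ) • b
  have e1 : a - w = (-(1 / 2) : ℝ) • (b - a) := by simp only [w]; module
  have e2 : b - w = (1 / 2 : ℝ) • (b - a) := by simp only [w]; module
  have h1 := hS.lower w hw a ha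
  have h2 := hS.lower w hw b hb
  have t1 := three_point c w a
  have t2 := three_point c w b
  rw [e1, inner_smul_right, norm_smul, mul_pow] at h1 t1
  rw [e2, inner_smul_right, norm_smul, mul_pow] at h2 t2
  norm_num at h1 h2 t1 t2
  simp only [smul_eq_mul] at hh
  have h3 : f w ≤ 1 / 2 * f a + 1 / 2 * f b + m / 8 * ‖b - a‖ ^ 2 := by linarith
  have h4 : p.lam * (f w + h w) ≤
      p.lam * (1 / 2 * f a + 1 / 2 * f b + m / 8 * ‖b - a‖ ^ 2 + (1 / 2 * h a + 1 / 2 * h b)) :=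
    mul_le_mul_of_nonneg_left (by linarith) hS.lam_pos.le
  have h5 : p.lam * (m / 8 * ‖b - a‖ ^ 2) = 1 / 32 * ‖b - a‖ ^ 2 := by
    linear_combination (‖b - a‖ ^ 2 / 8) * hS.lam_mul_m
  linarith

include hS in
/-- Strong convexity of the prox subproblem improves the `ε`-subgradient inequality. -/
lemma strong_subgradient (hi : ProxIterate X (fun v => f v + h v) p c x u ε) {v : E}
    (hv : v ∈ X) :
    p.lam * (f x + h x) + 1 / 2 * ‖x - c‖ ^ 2 + inner ℝ u (v - x) - 2 * ε +
      3 / 16 * ‖v - x‖ ^ 2 ≤ p.lam * (f v + h v) + 1 / 2 * ‖v - c‖ ^ 2 := by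
  -- Test the `ε`-subgradient inequality at the midpoint of `x` and `v`; rescaling by two afterwards
  -- is what doubles `ε`.
  have h1 := hS.midpoint_le hi.mem hv c
  have h2 := hi.subgradient ((1 / 2 : ℝ) • x + (1 / 2 : ℝ) • v)
    (hS.convexOn.1 hi.mem hv (by norm_num) (by norm_num) (by norm_num))
  have e : (1 / 2 : ℝ) • x + (1 / 2 : ℝ) • v - x = (1 / 2 : ℝ) • (v - x) := by module
  rw [e, inner_smul_right] at h2
  linarith

variable (hi : ProxIterate X (fun v => f v + h v) p c x u ε)
  (hi' : ProxIterate X (fun v => f v + h v) p c x' u' ε')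

include hS hi hi'

/-- Two late iterates of ACG calls with the same prox center are at comparable distances from
it. -/
lemma dist_iterates_le : ‖x' - x‖ ≤ 19 / 10 * ‖x - c‖ := by
  have h1 := hS.strong_subgradient hi hi'.mem
  have h2 := hS.strong_subgradient hi' hi.mem
  rw [norm_sub_rev x x'] at h2
  have e : inner ℝ u' (x - x') = - inner ℝ u' (x' - x) := by
    rw [← inner_neg_right, neg_sub]
  have b1 := (abs_le.1 (abs_real_inner_le_norm u (x' - x))).1
  have b2 := (abs_le.1 (abs_real_inner_le_norm u' (x' - x))).2
  have t : ‖x' - c‖ ≤ ‖x' - x‖ + ‖x - c‖ := norm_sub_le_norm_sub_add_norm_sub _ _ _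
  have n1 := mul_le_mul_of_nonneg_right hi.norm_u_le (norm_nonneg (x' - x))
  have n2 := mul_le_mul_of_nonneg_right (hi'.norm_u_le.trans
    (div_le_div_of_nonneg_right t (by norm_num))) (norm_nonneg (x' - x))
  have q1 := hi.eps_le
  have q2 := hi'.eps_le.trans (div_le_div_of_nonneg_right
    (pow_le_pow_left₀ (norm_nonneg _) t 2) (by norm_num))
  have hD := norm_nonneg (x - c)
  have hΔ := norm_nonneg (x' - x)
  set D := ‖x - c‖
  set Δ := ‖x' - x‖
  -- Collecting terms gives `15 Δ² ≤ 24 D Δ + 8 D²`, which forces `Δ ≤ 1.89 D`.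
  have key : 3 / 8 * Δ ^ 2 ≤ D / 9 * Δ + (Δ + D) / 9 * Δ + 2 * (D ^ 2 / 36) +
    2 * ((Δ + D) ^ 2 / 36) := by linarith
  by_contra! hlt
  nlinarith

lemma dist_center_le : ‖x' - c‖ ≤ 29 / 10 * ‖x - c‖ := by
  have t : ‖x' - c‖ ≤ ‖x' - x‖ + ‖x - c‖ := norm_sub_le_norm_sub_add_norm_sub _ _ _
  linarith [hS.dist_iterates_le hi hi']

/-- Transfers the test of step 2 to the iterate of step 3: `(10/9)(29/10)(9/8) = 29/8 ≤ 15/4`. -/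
lemma residual_le : ‖c - x' + u'‖ ≤ 15 / 4 * ‖c - x + u‖ := by
  have h1 := hS.dist_center_le hi hi'
  have h2 := hi'.norm_residual_le
  have h3 := hi.norm_residual_ge
  linarith [norm_nonneg (x - c)]

end Pair

/-- In an ACG call, the error of the iterate is below the threshold of step 3 once `A_j` is large
enough. -/
lemma eps_le_epsHat {c : E} {T : ACGTrace E} (hS : AIPPSetting X f h p m) (hc : c ∈ X)
    (hT : IsACG X (fun v => p.lam * f v + 1 / 4 * ‖v - c‖ ^ 2)
      (fun v => p.lam * h v + 1 / 4 * ‖v - c‖ ^ 2) p.acgMu p.acgL c T) {i j : ℕ}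
    (hi : p.minIter ≤ i) (hj : p.minIter ≤ j)
    (hsmall : ‖c - T.z i + T.u i‖ ≤ p.lam * p.rhoHat / 5) (hA : 2 * p.lam * p.M + 1 ≤ T.A j) :
    T.eps j ≤ p.epsHat * p.lam := by
  have hI := hS.proxIterate hc hT hi
  have h1 := hS.dist_center_le hI (hS.proxIterate hc hT hj)
  have h2 := hI.norm_residual_ge
  have hlM := hS.lam_mul_M_pos
  have hlam := hS.lam_pos
  have hM := hS.M_pos
  have hρ := hS.rho_pos
  unfold AIPPParams.rhoHat at hsmall
  -- The threshold is `λρ/20`, and `(29/10)(9/8)/20 < 1/6`.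
  have h3 : ‖T.z j - c‖ ≤ p.lam * p.rho * (1 / 6) := by nlinarith
  have h4 := pow_le_pow_left₀ (norm_nonneg _) h3 2
  have hApos : 0 < T.A j := by nlinarith
  refine (hS.eps_le_div hc hT hj).trans ?_
  rw [div_le_iff₀ (by positivity)]
  refine h4.trans ?_
  have e : p.epsHat * p.lam * (2 * T.A j) =
      (p.lam * p.rho) ^ 2 * T.A j / (16 * (p.lam * p.M + 1)) := by
    unfold AIPPParams.epsHat
    field_simp
    ring
  rw [e, le_div_iff₀ (by positivity)]
  have : (p.lam * p.rho) ^ 2 * (p.lam * p.M + 1) ≤ (p.lam * p.rho) ^ 2 * T.A j :=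
    mul_le_mul_of_nonneg_left (by linarith) (by positivity)
  have h6 : 0 ≤ (p.lam * p.rho) ^ 2 * (p.lam * p.M + 1) := by positivity
  nlinarith

end AIPPSetting

end InexactProx

end MinMaxSmoothing

namespace MinMaxSmoothing

open Filter Topology

/-! ### The smoothed objective: Danskin's theorem, curvature and Lipschitz bounds. -/

section Smoothing

namespace MinMaxProblem

lemma PhiXi_sub {E F : Type*} [NormedAddCommGroup F] {P : MinMaxProblem E F} {ξ : ℝ} {y₀ : F}
    (x x' : E) (y : F) :
    P.PhiXi ξ y₀ x y - P.PhiXi ξ y₀ x' y = P.Phi x y - P.Phi x' y := by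
  simp [PhiXi]

lemma isArgmin_of_isArgmax_PhiXi {E F : Type*} [NormedAddCommGroup F] {P : MinMaxProblem E F} {ξ : ℝ}
    {y₀ : F} {x : E} {y : F} (hy : IsArgmax P.Y (fun y' => P.PhiXi ξ y₀ x y') y) :
    IsArgmin P.Y (fun y' => -P.Phi x y' + (1 / ξ) / 2 * ‖y' - y₀‖ ^ 2) y := by
  refine ⟨hy.1, fun y' hy' => ?_⟩
  have h : P.PhiXi ξ y₀ x y' ≤ P.PhiXi ξ y₀ x y := hy.2 hy'
  have e : (1 / ξ) / 2 = 1 / (2 * ξ) := by rw [div_div, mul_comm]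
  simp only [PhiXi] at h
  change -P.Phi x y + (1 / ξ) / 2 * ‖y - y₀‖ ^ 2 ≤ -P.Phi x y' + (1 / ξ) / 2 * ‖y' - y₀‖ ^ 2
  rw [e]
  linarith

end MinMaxProblem

variable {E F : Type*} [NormedAddCommGroup E] [InnerProductSpace ℝ E] [CompleteSpace E]
  [NormedAddCommGroup F] [InnerProductSpace ℝ F]

namespace MinMaxProblem

variable {P : MinMaxProblem E F} {m Lx Ly ξ : ℝ} {y₀ : F}

/-- `Ω` is an open neighbourhood of `X` on which `Φ` has the assumed regularity. -/
structure SmoothOn (P : MinMaxProblem E F) (Ω : Set E) : Prop where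
  isOpen : IsOpen Ω
  subset : P.X ⊆ Ω
  continuousOn : ContinuousOn (fun q : E × F => P.Phi q.1 q.2) (Ω ×ˢ P.Y)
  differentiableAt : ∀ x ∈ Ω, ∀ y ∈ P.Y, DifferentiableAt ℝ (fun x' => P.Phi x' y) x
  continuousOn_gradX : ContinuousOn (fun q : E × F => P.gradX q.1 q.2) (Ω ×ˢ P.Y)
  concave : ∀ x ∈ Ω, ClosedConvexFn P.Y (fun y => -P.Phi x y)

lemma Assumptions.exists_smoothOn (hP : P.Assumptions m Lx Ly) : ∃ Ω, P.SmoothOn Ω := by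
  obtain ⟨Ω, h1, h2, h3, h4, h5, h6⟩ := hP.smooth
  exact ⟨Ω, h1, h2, h3, h4, h5, h6⟩

section Argmax

variable {Ω : Set E} (hΩ : P.SmoothOn Ω) {x : E} {y : F}

include hΩ

lemma SmoothOn.continuousOn_Phi (hx : x ∈ Ω) : ContinuousOn (P.Phi x) P.Y :=
  hΩ.continuousOn.comp (f := fun y => (x, y)) (by fun_prop) fun _ hy => ⟨hx, hy⟩

lemma SmoothOn.isArgmax_yXi (hY : IsCompact P.Y) (hx : x ∈ Ω) :
    IsArgmax P.Y (fun y' => P.PhiXi ξ y₀ x y') (P.yXi ξ y₀ x) := by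
  have hc := hΩ.continuousOn_Phi hx
  have : ContinuousOn (fun y' => P.PhiXi ξ y₀ x y') P.Y := by
    unfold PhiXi
    exact hc.sub (by fun_prop)
  obtain ⟨y, hy, hmax⟩ := hY.exists_isMaxOn (hΩ.concave x hx).nonempty this
  exact Classical.epsilon_spec (p := fun y => IsArgmax P.Y (fun y' => P.PhiXi ξ y₀ x y') y)
    ⟨y, hy, hmax⟩

lemma SmoothOn.argmax_growth (hx : x ∈ Ω) (hy : IsArgmax P.Y (fun y' => P.PhiXi ξ y₀ x y') y)
    {y' : F} (hy' : y' ∈ P.Y) :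
    P.PhiXi ξ y₀ x y' + 1 / (2 * ξ) * ‖y' - y‖ ^ 2 ≤ P.PhiXi ξ y₀ x y := by
  have h := (isArgmin_of_isArgmax_PhiXi hy).prox_growth (hΩ.concave x hx).convexOn hy'
  have e : (1 / ξ) / 2 = 1 / (2 * ξ) := by rw [div_div, mul_comm]
  rw [e] at h
  simp only [PhiXi]
  linarith

lemma SmoothOn.argmax_unique (hξ : 0 < ξ) (hY : IsCompact P.Y) (hx : x ∈ Ω)
    (hy : IsArgmax P.Y (fun y' => P.PhiXi ξ y₀ x y') y) : y = P.yXi ξ y₀ x := by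
  have h := hΩ.isArgmax_yXi hY hx (ξ := ξ) (y₀ := y₀)
  have h1 := hΩ.argmax_growth hx h hy.1
  have h2 : P.PhiXi ξ y₀ x (P.yXi ξ y₀ x) ≤ P.PhiXi ξ y₀ x y := hy.2 h.1
  have h3 : 1 / (2 * ξ) * ‖y - P.yXi ξ y₀ x‖ ^ 2 ≤ 0 := by linarith
  have h4 : ‖y - P.yXi ξ y₀ x‖ ^ 2 ≤ 0 := nonpos_of_mul_nonpos_right h3 (by positivity)
  rw [← sub_eq_zero, ← norm_eq_zero]
  exact pow_eq_zero_iff two_ne_zero |>.1 (le_antisymm h4 (by positivity))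

lemma SmoothOn.pXi_eq (hY : IsCompact P.Y) (hx : x ∈ Ω) :
    P.pXi ξ y₀ x = P.PhiXi ξ y₀ x (P.yXi ξ y₀ x) := by
  have h := hΩ.isArgmax_yXi hY hx (ξ := ξ) (y₀ := y₀)
  refine IsGreatest.csSup_eq ⟨⟨_, h.1, rfl⟩, ?_⟩
  rintro _ ⟨y', hy', rfl⟩
  exact h.2 hy'

lemma SmoothOn.PhiXi_le_pXi (hY : IsCompact P.Y) (hx : x ∈ Ω) (hy : y ∈ P.Y) :
    P.PhiXi ξ y₀ x y ≤ P.pXi ξ y₀ x := by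
  rw [hΩ.pXi_eq hY hx]
  exact (hΩ.isArgmax_yXi hY hx).2 hy

lemma SmoothOn.hasGradientAt_Phi (hx : x ∈ Ω) (hy : y ∈ P.Y) :
    HasGradientAt (fun x' => P.Phi x' y) (P.gradX x y) x :=
  (hΩ.differentiableAt x hx y hy).hasGradientAt

lemma SmoothOn.eventually_abs_Phi_sub_lt (hY : IsCompact P.Y) (hx : x ∈ Ω) {η : ℝ} (hη : 0 < η) :
    ∀ᶠ x' in 𝓝 x, ∀ y ∈ P.Y, |P.Phi x' y - P.Phi x y| < η := by
  have := hY.eventually_forall_of_forall_eventually (x₀ := x)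
    (P := fun x' y => y ∈ P.Y → |P.Phi x' y - P.Phi x y| < η) ?_
  · filter_upwards [this] with x' h y hy using h y hy hy
  intro y hy
  have h1 : Tendsto (fun q : E × F => P.Phi q.1 q.2 - P.Phi x q.2) (𝓝[Ω ×ˢ P.Y] (x, y))
      (𝓝 (P.Phi x y - P.Phi x y)) := by
    refine (hΩ.continuousOn (x, y) ⟨hx, hy⟩).sub ?_
    exact ((hΩ.continuousOn_Phi hx) y hy).comp (f := fun q : E × F => q.2) (s := Ω ×ˢ P.Y)
      (x := (x, y)) continuousWithinAt_snd fun q hq => hq.2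
  rw [sub_self] at h1
  have h2 := h1.eventually (Metric.ball_mem_nhds 0 hη)
  rw [eventually_nhdsWithin_iff] at h2
  have h3 : ∀ᶠ q : E × F in 𝓝 (x, y), q.1 ∈ Ω :=
    continuousAt_fst.eventually (hΩ.isOpen.mem_nhds hx)
  filter_upwards [h2, h3] with q hq hq' hqY
  simpa using hq ⟨hq', hqY⟩

/-- Compactness of `Y` makes `Φ(x', ·)` uniformly close to `Φ(x, ·)`, and quadratic growth at the
maximizer turns close objectives into close maximizers. -/
lemma SmoothOn.continuousAt_yXi (hξ : 0 < ξ) (hY : IsCompact P.Y) (hx : x ∈ Ω) :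
    ContinuousAt (P.yXi ξ y₀) x := by
  rw [Metric.continuousAt_iff']
  intro δ hδ
  filter_upwards [hΩ.eventually_abs_Phi_sub_lt hY hx
    (show 0 < 1 / (4 * ξ) * δ ^ 2 by positivity), hΩ.isOpen.mem_nhds hx] with x' h hx'
  have hy := hΩ.isArgmax_yXi hY hx (ξ := ξ) (y₀ := y₀)
  have hy' := hΩ.isArgmax_yXi hY hx' (ξ := ξ) (y₀ := y₀)
  have h1 := hΩ.argmax_growth hx hy hy'.1
  have h2 : P.PhiXi ξ y₀ x' (P.yXi ξ y₀ x) ≤ P.PhiXi ξ y₀ x' (P.yXi ξ y₀ x') := hy'.2 hy.1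
  have h3 := abs_lt.1 (h _ hy.1)
  have h4 := abs_lt.1 (h _ hy'.1)
  have e1 := PhiXi_sub (P := P) (ξ := ξ) (y₀ := y₀) x' x (P.yXi ξ y₀ x)
  have e2 := PhiXi_sub (P := P) (ξ := ξ) (y₀ := y₀) x' x (P.yXi ξ y₀ x')
  have h5 : 1 / (2 * ξ) * ‖P.yXi ξ y₀ x' - P.yXi ξ y₀ x‖ ^ 2 < 1 / (2 * ξ) * δ ^ 2 := by
    have : 1 / (2 * ξ) * δ ^ 2 = 2 * (1 / (4 * ξ) * δ ^ 2) := by field_simp; ring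
    linarith
  have h6 := lt_of_mul_lt_mul_left h5 (by positivity)
  rw [dist_eq_norm]
  exact lt_of_pow_lt_pow_left₀ 2 hδ.le h6

/-- Danskin's theorem for the smoothed objective. -/
lemma SmoothOn.hasGradientAt_pXi (hξ : 0 < ξ) (hY : IsCompact P.Y) (hx : x ∈ Ω) :
    HasGradientAt (P.pXi ξ y₀) (P.gradX x (P.yXi ξ y₀ x)) x := by
  set y := P.yXi ξ y₀ x with hy_def
  have hy := hΩ.isArgmax_yXi hY hx (ξ := ξ) (y₀ := y₀)
  rw [hasGradientAt_iff_isLittleO, Asymptotics.isLittleO_iff]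
  intro c hc
  obtain ⟨δ, hδ, hgrad⟩ := Metric.continuousWithinAt_iff.1
    (hΩ.continuousOn_gradX (x, y) ⟨hx, hy.1⟩) c hc
  obtain ⟨δ', hδ', hball⟩ := Metric.isOpen_iff.1 hΩ.isOpen x hx
  have hr : 0 < min δ δ' := lt_min hδ hδ'
  -- The mean value inequality, uniform over all `y'` near `y`; uniformity is needed because the
  -- maximizer moves with `x'`.
  have hmv : ∀ x' ∈ Metric.ball x (min δ δ'), ∀ y' ∈ P.Y, dist y' y < δ →
      ‖P.Phi x' y' - P.Phi x y' - inner ℝ (P.gradX x y) (x' - x)‖ ≤ c * ‖x' - x‖ := by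
    intro x' hx' y' hy' hd
    have hsub : Metric.ball x (min δ δ') ⊆ Ω :=
      (Metric.ball_subset_ball (min_le_right _ _)).trans hball
    have := (convex_ball x (min δ δ')).norm_image_sub_le_of_norm_hasFDerivWithin_le' (𝕜 := ℝ)
      (f := fun x' => P.Phi x' y') (φ := InnerProductSpace.toDual ℝ E (P.gradX x y)) (C := c)
      (fun w hw => (hΩ.hasGradientAt_Phi (hsub hw) hy').hasFDerivAt.hasFDerivWithinAt)
      (fun w hw => ?_) (Metric.mem_ball_self hr) hx'
    · simpa using this
    · rw [← map_sub, LinearIsometryEquiv.norm_map, ← dist_eq_norm]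
      refine (hgrad (x := (w, y')) ⟨hsub hw, hy'⟩ ?_).le
      rw [Prod.dist_eq]
      exact max_lt ((Metric.mem_ball.1 hw).trans_le (min_le_left _ _)) hd
  filter_upwards [Metric.ball_mem_nhds x hr, hΩ.isOpen.mem_nhds hx,
    Metric.continuousAt_iff'.1 (hΩ.continuousAt_yXi hξ hY hx (y₀ := y₀)) δ hδ] with x' hb hx' hd
  have hy' := hΩ.isArgmax_yXi hY hx' (ξ := ξ) (y₀ := y₀)
  -- The increment of `p_ξ` lies between those of `Φ(·, y_ξ(x))` and `Φ(·, y_ξ(x'))`, and both have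
  -- the same linearization up to `c ‖x' - x‖`.
  have h1 := abs_le.1 (hmv x' hb y hy.1 (by simpa using hδ))
  have h2 := abs_le.1 (hmv x' hb _ hy'.1 hd)
  have e1 := PhiXi_sub (P := P) (ξ := ξ) (y₀ := y₀) x' x y
  have e2 := PhiXi_sub (P := P) (ξ := ξ) (y₀ := y₀) x' x (P.yXi ξ y₀ x')
  have m1 := hΩ.PhiXi_le_pXi hY hx' hy.1 (ξ := ξ) (y₀ := y₀)
  have m2 := hΩ.PhiXi_le_pXi hY hx hy'.1 (ξ := ξ) (y₀ := y₀)
  have q1 := hΩ.pXi_eq hY hx (ξ := ξ) (y₀ := y₀)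
  have q2 := hΩ.pXi_eq hY hx' (ξ := ξ) (y₀ := y₀)
  rw [← hy_def] at m1 q1
  rw [Real.norm_eq_abs, abs_le]
  constructor <;> linarith

end Argmax

namespace Assumptions

variable (hP : P.Assumptions m Lx Ly) {x x' : E}

include hP

lemma Lx_pos : 0 < Lx := hP.m_pos.trans_le hP.m_le

lemma yXi_mem (hx : x ∈ P.X) : P.yXi ξ y₀ x ∈ P.Y := by
  obtain ⟨Ω, hΩ⟩ := hP.exists_smoothOn
  exact (hΩ.isArgmax_yXi hP.Y_compact (hΩ.subset hx)).1

lemma hasGradientAt_pXi (hξ : 0 < ξ) (hx : x ∈ P.X) :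
    HasGradientAt (P.pXi ξ y₀) (P.gradX x (P.yXi ξ y₀ x)) x := by
  obtain ⟨Ω, hΩ⟩ := hP.exists_smoothOn
  exact hΩ.hasGradientAt_pXi hξ hP.Y_compact (hΩ.subset hx)

lemma gradient_pXi (hξ : 0 < ξ) (hx : x ∈ P.X) :
    gradient (P.pXi ξ y₀) x = P.gradX x (P.yXi ξ y₀ x) := (hP.hasGradientAt_pXi hξ hx).gradient

/-- Freeze the maximizer of `x`: `p_ξ(x') ≥ Φ_ξ(x', y_ξ(x))`, with equality at `x' = x`, so the
curvature bound of `Φ` is inherited. -/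
lemma pXi_lower (hξ : 0 < ξ) (hx : x ∈ P.X) (hx' : x' ∈ P.X) :
    P.pXi ξ y₀ x + inner ℝ (gradient (P.pXi ξ y₀) x) (x' - x) - m / 2 * ‖x' - x‖ ^ 2 ≤
      P.pXi ξ y₀ x' := by
  obtain ⟨Ω, hΩ⟩ := hP.exists_smoothOn
  have hy := hP.yXi_mem hx (ξ := ξ) (y₀ := y₀)
  rw [hP.gradient_pXi hξ hx, hΩ.pXi_eq hP.Y_compact (hΩ.subset hx)]
  have h1 := hΩ.PhiXi_le_pXi hP.Y_compact (hΩ.subset hx') hy (ξ := ξ) (y₀ := y₀)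
  have h2 := hP.lower_curvature x' hx' x hx _ hy
  have h3 := PhiXi_sub (P := P) (ξ := ξ) (y₀ := y₀) x' x (P.yXi ξ y₀ x)
  linarith

lemma Phi_upper {y : F} (hy : y ∈ P.Y) (hx : x ∈ P.X) (hx' : x' ∈ P.X) :
    P.Phi x' y ≤ P.Phi x y + inner ℝ (P.gradX x y) (x' - x) + Lx / 2 * ‖x' - x‖ ^ 2 := by
  obtain ⟨Ω, hΩ⟩ := hP.exists_smoothOn
  refine descent_lemma (f := fun x => P.Phi x y) (G := fun x => P.gradX x y) hP.X_convex
    (fun w hw => hΩ.hasGradientAt_Phi (hΩ.subset hw) hy) (fun w hw w' hw' => ?_) hx hx'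
  simpa using hP.grad_lipschitz w hw w' hw' y hy y hy

/-- Adding the growth inequalities at the two maximizers bounds `δ² / ξ` by a mixed difference of
`Φ`. The upper curvature `Lx` at one maximizer and the lower curvature `m` at the other leave `Ly δ
r + (Lx + m) r² / 2`. -/
lemma yXi_lipschitz (hξ : 0 < ξ) (hx : x ∈ P.X) (hx' : x' ∈ P.X) :
    ‖P.yXi ξ y₀ x - P.yXi ξ y₀ x'‖ ≤ Qxi m Lx Ly ξ * ‖x - x'‖ := by
  obtain ⟨Ω, hΩ⟩ := hP.exists_smoothOn
  have hy := hΩ.isArgmax_yXi hP.Y_compact (hΩ.subset hx) (ξ := ξ) (y₀ := y₀)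
  have hy' := hΩ.isArgmax_yXi hP.Y_compact (hΩ.subset hx') (ξ := ξ) (y₀ := y₀)
  have g1 := hΩ.argmax_growth (hΩ.subset hx) hy hy'.1
  have g2 := hΩ.argmax_growth (hΩ.subset hx') hy' hy.1
  set y := P.yXi ξ y₀ x
  set y' := P.yXi ξ y₀ x'
  have e1 := PhiXi_sub (P := P) (ξ := ξ) (y₀ := y₀) x x' y
  have e2 := PhiXi_sub (P := P) (ξ := ξ) (y₀ := y₀) x x' y'
  have c1 := hP.lower_curvature x hx x' hx' y' hy'.1
  have c2 := hP.Phi_upper hy.1 hx' hx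
  have c3 := hP.grad_lipschitz x' hx' x' hx' y hy.1 y' hy'.1
  have c4 := real_inner_le_norm (P.gradX x' y - P.gradX x' y') (x - x')
  rw [inner_sub_left] at c4
  rw [sub_self, norm_zero, mul_zero, zero_add] at c3
  have c5 := mul_le_mul_of_nonneg_right c3 (norm_nonneg (x - x'))
  rw [norm_sub_rev y' y] at g1
  have hδ := norm_nonneg (y - y')
  have hr := norm_nonneg (x - x')
  set δ := ‖y - y'‖
  set r := ‖x - x'‖
  have k1 : 1 / (2 * ξ) * δ ^ 2 + 1 / (2 * ξ) * δ ^ 2 ≤ Ly * δ * r + (Lx + m) / 2 * r ^ 2 := by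
    linarith
  have k2 : δ ^ 2 ≤ ξ * Ly * δ * r + ξ * (Lx + m) / 2 * r ^ 2 := by
    have := mul_le_mul_of_nonneg_left k1 hξ.le
    have e : ξ * (1 / (2 * ξ) * δ ^ 2 + 1 / (2 * ξ) * δ ^ 2) = δ ^ 2 := by field_simp; ring
    linarith
  have hpos : 0 < ξ * (Lx + m) := mul_pos hξ (add_pos hP.Lx_pos hP.m_pos)
  have hs := Real.sq_sqrt hpos.le
  have hs0 := Real.sqrt_nonneg (ξ * (Lx + m))
  have hL := mul_pos hξ hP.Ly_pos
  unfold Qxi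
  set s := √(ξ * (Lx + m))
  -- If `δ > (ξ Ly + s) r`, then `s r ≤ δ`, so `δ² > ξ Ly r δ + s² r²`, against `k2`.
  by_contra! hlt
  have h1 : s * r ≤ δ := by nlinarith [mul_nonneg hL.le hr]
  have h2 : (s * r) * (s * r) ≤ s * r * δ := mul_le_mul_of_nonneg_left h1 (by positivity)
  have h3 : (ξ * Ly + s) * r * δ < δ * δ := by
    refine mul_lt_mul_of_pos_right hlt (lt_of_le_of_lt (by positivity) hlt)
  nlinarith [mul_nonneg hpos.le (sq_nonneg r)]

lemma gradient_pXi_lipschitz (hξ : 0 < ξ) (hx : x ∈ P.X) (hx' : x' ∈ P.X) :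
    ‖gradient (P.pXi ξ y₀) x - gradient (P.pXi ξ y₀) x'‖ ≤ Lxi m Lx Ly ξ * ‖x - x'‖ := by
  rw [hP.gradient_pXi hξ hx, hP.gradient_pXi hξ hx']
  have h1 := hP.grad_lipschitz x hx x' hx' _ (hP.yXi_mem hx (ξ := ξ) (y₀ := y₀)) _
    (hP.yXi_mem hx' (ξ := ξ) (y₀ := y₀))
  have h2 := mul_le_mul_of_nonneg_left (hP.yXi_lipschitz hξ hx hx' (y₀ := y₀)) hP.Ly_pos.le
  unfold Lxi
  linarith

lemma Lx_le_Lxi (hξ : 0 < ξ) : Lx ≤ Lxi m Lx Ly ξ := by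
  have := hP.Ly_pos
  have := hP.m_pos
  have := hP.Lx_pos
  unfold Lxi Qxi
  have : 0 ≤ Ly * (ξ * Ly + √(ξ * (Lx + m))) := by positivity
  linarith

lemma aippSetting (hξ : 0 < ξ) {ρ : ℝ} (hρ : 0 < ρ) (y₀ : F) :
    AIPPSetting P.X (P.pXi ξ y₀) P.h (aippsParams m Lx Ly ξ ρ) m where
  m_pos := hP.m_pos
  m_le := hP.m_le.trans (hP.Lx_le_Lxi hξ)
  lam_eq := rfl
  sigma_eq := rfl
  rho_pos := hρ
  convexOn := hP.h_closedConvex.convexOn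
  hasGradientAt := fun _ hx => (hP.hasGradientAt_pXi hξ hx).differentiableAt.hasGradientAt
  lower := fun _ hx _ hv => hP.pXi_lower hξ hx hv
  lipschitz := fun _ hx _ hv => hP.gradient_pXi_lipschitz hξ hx hv

lemma norm_sub_le_Dy {y y' : F} (hy : y ∈ P.Y) (hy' : y' ∈ P.Y) : ‖y - y'‖ ≤ P.Dy := by
  rw [← dist_eq_norm]
  exact Metric.dist_le_diam_of_mem hP.Y_compact.isBounded hy hy'

lemma pXi_le_p (hξ : 0 < ξ) (hx : x ∈ P.X) : P.pXi ξ y₀ x ≤ P.p x := by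
  obtain ⟨Ω, hΩ⟩ := hP.exists_smoothOn
  rw [hΩ.pXi_eq hP.Y_compact (hΩ.subset hx)]
  have h1 : P.Phi x (P.yXi ξ y₀ x) ≤ P.p x :=
    le_csSup (hP.Y_compact.bddAbove_image (hΩ.continuousOn_Phi (hΩ.subset hx)))
      ⟨_, hP.yXi_mem hx, rfl⟩
  have h2 : 0 ≤ 1 / (2 * ξ) * ‖P.yXi ξ y₀ x - y₀‖ ^ 2 := by positivity
  simp only [PhiXi]
  linarith

lemma p_le_pXi_add (hξ : 0 < ξ) (hy₀ : y₀ ∈ P.Y) (hx : x ∈ P.X) :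
    P.p x ≤ P.pXi ξ y₀ x + P.Dy ^ 2 / (2 * ξ) := by
  obtain ⟨Ω, hΩ⟩ := hP.exists_smoothOn
  refine csSup_le (hP.Y_nonempty.image _) ?_
  rintro _ ⟨y, hy, rfl⟩
  have h1 := hΩ.PhiXi_le_pXi hP.Y_compact (hΩ.subset hx) hy (ξ := ξ) (y₀ := y₀)
  have h2 : 1 / (2 * ξ) * ‖y - y₀‖ ^ 2 ≤ 1 / (2 * ξ) * P.Dy ^ 2 := by
    gcongr
    exact hP.norm_sub_le_Dy hy hy₀
  simp only [PhiXi] at h1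
  rw [div_eq_mul_one_div, mul_comm (P.Dy ^ 2)]
  linarith

end Assumptions

end MinMaxProblem

end Smoothing

end MinMaxSmoothing

namespace MinMaxSmoothing

/-! ### Stationarity of the output. -/

section Stationarity

variable {E F : Type*} [NormedAddCommGroup E] [InnerProductSpace ℝ E] [CompleteSpace E]
  [NormedAddCommGroup F] [InnerProductSpace ℝ F]

namespace AIPPSetting

variable {X : Set E} {f h : E → ℝ} {p : AIPPParams} {m : ℝ}

lemma convexOn_linearized (hS : AIPPSetting X f h p m) (w z : E) :
    ConvexOn ℝ X (fun v => inner ℝ w (v - z) + h v) := by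
  refine ConvexOn.add ⟨hS.convexOn.1, fun a _ b _ s t _ _ hst => le_of_eq ?_⟩ hS.convexOn
  simp only [inner_sub_right, inner_add_right, inner_smul_right, smul_eq_mul]
  linear_combination (inner ℝ w z) * hst

/-- The prox-gradient step of step 4 turns an approximate solution of the prox subproblem into an
approximate stationary point. -/
lemma refinement (hS : AIPPSetting X f h p m) {c z u xbar : E} {ε : ℝ}
    (hi : ProxIterate X (fun v => f v + h v) p c z u ε) (hε : ε ≤ p.epsHat * p.lam)
    (hr : ‖c - z + u‖ ≤ 3 / 16 * (p.lam * p.rho))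
    (hx : IsArgmin X (fun v => inner ℝ (gradient f z) (v - z) + h v + p.Mlam / 2 * ‖v - z‖ ^ 2)
      xbar) :
    p.Mlam • (z - xbar) - gradient f z ∈ subdiff X h xbar ∧
      ‖p.Mlam • (z - xbar) + gradient f xbar - gradient f z‖ ≤ p.rho := by
  have hconv := hS.convexOn_linearized (gradient f z) z
  refine ⟨⟨hx.1, fun v hv => ?_⟩, ?_⟩
  · have h1 := hx.prox_subgradient hconv hv
    have e : inner ℝ (gradient f z) (v - z) =
        inner ℝ (gradient f z) (v - xbar) + inner ℝ (gradient f z) (xbar - z) := by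
      rw [← inner_add_right, sub_add_sub_cancel]
    rw [inner_sub_left, inner_smul_left, conj_trivial]
    linarith
  have hlam := hS.lam_pos
  have hM := hS.M_pos
  have hρ := hS.rho_pos
  have hMl : 0 < p.Mlam := by unfold AIPPParams.Mlam; positivity
  have g := hx.prox_growth hconv hi.mem
  simp only [sub_self, norm_zero, inner_zero_right] at g
  have hup := hS.upper hi.mem hx.1
  have hsub := hi.subgradient xbar hx.1
  have ht := three_point c z xbar
  have hcs := (abs_le.1 (abs_real_inner_le_norm (c - z + u) (xbar - z))).1
  rw [inner_add_left] at hcs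
  have hlip := hS.lipschitz xbar hx.1 z hi.mem
  have hn := norm_add_le (p.Mlam • (z - xbar)) (gradient f xbar - gradient f z)
  rw [norm_smul, Real.norm_of_nonneg hMl.le, norm_sub_rev z xbar, ← add_sub_assoc] at hn
  rw [norm_sub_rev z xbar] at g
  have hd := norm_nonneg (xbar - z)
  have hcs' := mul_le_mul_of_nonneg_right hr hd
  set d := ‖xbar - z‖
  -- Add the growth of the prox-gradient step at `z`, the descent lemma and the `ε`-subgradient
  -- inequality at `xbar`; the terms with the center combine into the residual `c - z + u`.
  have k1 : p.lam * (p.Mlam * d ^ 2) ≤ p.lam * (p.M / 2 * d ^ 2) + 1 / 2 * d ^ 2 +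
      3 / 16 * (p.lam * p.rho) * d + p.epsHat * p.lam := by
    have g' := mul_le_mul_of_nonneg_left (show p.Mlam * d ^ 2 ≤
      h z - h xbar - inner ℝ (gradient f z) (xbar - z) by linarith) hlam.le
    have hup' := mul_le_mul_of_nonneg_left hup hlam.le
    linarith
  have e1 : p.lam * p.Mlam = p.lam * p.M + 1 := by unfold AIPPParams.Mlam; field_simp
  have k2 : p.lam * (p.Mlam / 2 * d ^ 2) ≤ p.lam * (3 / 16 * p.rho * d + p.epsHat) := by
    have : p.lam * (p.Mlam / 2 * d ^ 2) =
      p.lam * (p.Mlam * d ^ 2) - (p.lam * p.M + 1) / 2 * d ^ 2 := by rw [← e1]; ring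
    linarith
  have k3 := le_of_mul_le_mul_left k2 hlam
  have e2 : p.epsHat * p.Mlam = p.rho ^ 2 / 32 := by
    unfold AIPPParams.epsHat
    change p.rho ^ 2 / (32 * p.Mlam) * p.Mlam = _
    field_simp
  have k4 := mul_le_mul_of_nonneg_right k3 hMl.le
  -- For `s = Mlam * d`, the bounds say `s² / 2 ≤ (3/16) ρ s + ρ² / 32`, which factors in this way.
  -- So `s ≤ ρ/2`, and the gradient difference contributes the other `ρ/2`.
  have k5 : (p.Mlam * d - p.rho / 2) * (p.Mlam * d + p.rho / 8) ≤ 0 := by nlinarith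
  have k6 : p.Mlam * d ≤ p.rho / 2 := by
    by_contra! hlt
    have : 0 < (p.Mlam * d - p.rho / 2) * (p.Mlam * d + p.rho / 8) :=
      mul_pos (by linarith) (by positivity)
    linarith
  have k7 : p.M * d ≤ p.Mlam * d := by
    apply mul_le_mul_of_nonneg_right _ hd
    unfold AIPPParams.Mlam
    have : 0 < p.lam⁻¹ := by positivity
    linarith
  linarith

lemma center_mem {x₀ : E} {T : AIPPTrace E} (hT : IsAIPPRun X f h p x₀ T) (hx₀ : x₀ ∈ X) {k : ℕ}
    (hk : k < T.K) : T.x k ∈ X := by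
  cases k with
  | zero => rwa [hT.x_zero]
  | succ k =>
    rw [(hT.step2_continue (k + 1) (by omega) hk).2]
    exact (hT.step1 (k + 1) (by omega) hk.le).1.2.2.1.1

lemma output_stationary (hS : AIPPSetting X f h p m) {x₀ : E} {T : AIPPTrace E}
    (hT : IsAIPPRun X f h p x₀ T) (hx₀ : x₀ ∈ X) :
    (∃ s ∈ subdiff X h T.xbar, T.ubar = gradient f T.xbar + s) ∧ ‖T.ubar‖ ≤ p.rho := by
  have hK := hT.one_le_K
  have hc := center_mem hT hx₀ (k := T.K - 1) (by omega)
  have hcall := hT.acg_call T.K hK le_rfl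
  have hi := hS.proxIterate hc hcall (hT.step1 T.K hK le_rfl).1.1
  have hi' := hS.proxIterate hc hcall hT.step3.1.1
  have hr := hS.residual_le hi hi'
  have hsmall := hT.step2_stop
  unfold AIPPParams.rhoHat at hsmall
  -- The constant `3/16` of `refinement` is `(15/4) / 20`.
  obtain ⟨h1, h2⟩ := hS.refinement hi' hT.step3.1.2.2 (by linarith) hT.step4_xbar
  rw [hT.step4_ubar]
  exact ⟨⟨_, h1, by abel⟩, h2⟩

end AIPPSetting

namespace MinMaxProblem

variable {P : MinMaxProblem E F} {m Lx Ly ξ : ℝ}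

lemma Assumptions.subdiff_yXi (hP : P.Assumptions m Lx Ly) {x : E} (hx : x ∈ P.X) (y₀ : F) :
    (1 / ξ) • (y₀ - P.yXi ξ y₀ x) ∈ subdiff P.Y (fun y' => -P.Phi x y') (P.yXi ξ y₀ x) := by
  obtain ⟨Ω, hΩ⟩ := hP.exists_smoothOn
  have hy := hΩ.isArgmax_yXi hP.Y_compact (hΩ.subset hx) (ξ := ξ) (y₀ := y₀)
  refine ⟨hy.1, fun y' hy' => ?_⟩
  have := (isArgmin_of_isArgmax_PhiXi hy).prox_subgradient
    (hΩ.concave x (hΩ.subset hx)).convexOn hy'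
  rw [inner_smul_left, conj_trivial, sub_zero]
  exact this

theorem Assumptions.isPrimalDualStationary (hP : P.Assumptions m Lx Ly) {x₀ : E} (hx₀ : x₀ ∈ P.X)
    {y₀ : F} (hy₀ : y₀ ∈ P.Y) {ρx ρy : ℝ} (hρx : 0 < ρx) (hρy : 0 < ρy) (hξ : 0 < ξ)
    (hD : P.Dy / ρy ≤ ξ) {x u : E} (hout : P.IsAIPPSOutput m Lx Ly ξ x₀ y₀ ρx x u) :
    P.IsPrimalDualStationary ρx ρy u ((1 / ξ) • (y₀ - P.yXi ξ y₀ x)) x (P.yXi ξ y₀ x) := by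
  obtain ⟨T, hT, rfl, rfl⟩ := hout
  have hx : T.xbar ∈ P.X := hT.step4_xbar.1
  obtain ⟨⟨s, hs, hu⟩, hnorm⟩ := (hP.aippSetting hξ hρx y₀).output_stationary hT hx₀
  refine ⟨⟨s, hs, by rw [hu, hP.gradient_pXi hξ hx]⟩, hP.subdiff_yXi hx y₀, hnorm, ?_⟩
  have h1 := hP.norm_sub_le_Dy hy₀ (hP.yXi_mem hx (ξ := ξ) (y₀ := y₀))
  rw [div_le_iff₀ hρy] at hD
  rw [norm_smul, Real.norm_of_nonneg (by positivity), one_div_mul_eq_div, div_le_iff₀ hξ]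
  linarith

end MinMaxProblem

end Stationarity

end MinMaxSmoothing

namespace MinMaxSmoothing

noncomputable section

/-! ### Execution and query count of the oracle program. -/

section ProgramStates

variable {E F α : Type*} [NormedAddCommGroup E] [InnerProductSpace ℝ E]
  [NormedAddCommGroup F]

/-- The memory of an ACG call after one more iteration. -/
def acgNext (O : Oracle E F) (p : AIPPParams) (ξ : ℝ) (y₀ : F) (c : E) (s : ACGState E) :
    ACGState E :=
  ((acgIteration p ξ y₀ c s OracleProg.done).run O).1

/-- The memory of the ACG call with initial point `c` after `j` iterations. -/
def acgState (O : Oracle E F) (p : AIPPParams) (ξ : ℝ) (y₀ : F) (c : E) : ℕ → ACGState E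
  | 0 => ACGState.init c
  | j + 1 => acgNext O p ξ y₀ c (acgState O p ξ y₀ c j)

/-- The sequences computed by the ACG program. -/
def programTrace (O : Oracle E F) (p : AIPPParams) (ξ : ℝ) (y₀ : F) (c : E) : ACGTrace E where
  A j := (acgState O p ξ y₀ c j).A
  ztil j := ((acgState O p ξ y₀ c j).A / (acgState O p ξ y₀ c (j + 1)).A) •
      (acgState O p ξ y₀ c j).z +
    (((acgState O p ξ y₀ c (j + 1)).A - (acgState O p ξ y₀ c j).A) /
      (acgState O p ξ y₀ c (j + 1)).A) • (acgState O p ξ y₀ c j).y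
  Gam j v := (acgState O p ξ y₀ c j).alpha + inner ℝ (acgState O p ξ y₀ c j).beta v
  y j := (acgState O p ξ y₀ c j).y
  z j := (acgState O p ξ y₀ c j).z
  u j := (acgState O p ξ y₀ c j).u
  eps j := (acgState O p ξ y₀ c j).eps

variable (O : Oracle E F) (p : AIPPParams) (ξ : ℝ) (y₀ : F) (c : E)

/-- Nine queries: two smoothed evaluations of three each, one resolvent, two values of `h`. -/
lemma run_acgIteration (s : ACGState E) (k : ACGState E → OracleProg E F α) :
    (acgIteration p ξ y₀ c s k).run O = (((k (acgNext O p ξ y₀ c s)).run O).1,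
      ((k (acgNext O p ξ y₀ c s)).run O).2 + 9) := rfl

lemma finalStep_run (z : E) :
    ((finalStep p ξ y₀ z).run O).1 =
      .halted (O.proxH (1 / p.Mlam) (z - p.Mlam⁻¹ • O.gradPhi z (O.proxPhi ξ z y₀)))
        (p.Mlam • (z - O.proxH (1 / p.Mlam) (z - p.Mlam⁻¹ • O.gradPhi z (O.proxPhi ξ z y₀))) +
          O.gradPhi (O.proxH (1 / p.Mlam) (z - p.Mlam⁻¹ • O.gradPhi z (O.proxPhi ξ z y₀)))
            (O.proxPhi ξ (O.proxH (1 / p.Mlam)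
              (z - p.Mlam⁻¹ • O.gradPhi z (O.proxPhi ξ z y₀))) y₀) -
          O.gradPhi z (O.proxPhi ξ z y₀)) := rfl

lemma acgState_j (j : ℕ) : (acgState O p ξ y₀ c j).j = j := by
  induction j with
  | zero => rfl
  | succ j ih => exact congrArg (· + 1) ih

variable {O p ξ y₀ c} {x₀ : E} {n q : ℕ}

/-- Before index `minIter`, acceptance fails on the iteration count alone. -/
lemma schemeExec_step1 (hn : schemeExec O p ξ x₀ y₀ n = (.step1 c (ACGState.init c), q)) {i : ℕ}
    (hi : i < p.minIter) :
    schemeExec O p ξ x₀ y₀ (n + i) = (.step1 c (acgState O p ξ y₀ c i), q + 9 * i) := by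
  induction i with
  | zero => exact hn
  | succ i ih =>
    rw [← add_assoc, schemeExec, ih (by omega)]
    have hna : ¬ (acgNext O p ξ y₀ c (acgState O p ξ y₀ c i)).accept p c := fun h => by
      have h1 := h.1
      have h2 := acgState_j O p ξ y₀ c (i + 1)
      rw [acgState] at h2
      omega
    simp only [schemeStep, run_acgIteration, if_neg hna, OracleProg.run, acgState]
    rw [Prod.mk.injEq]
    exact ⟨rfl, by ring⟩

open Classical in
lemma schemeExec_step1_end (hn : schemeExec O p ξ x₀ y₀ n = (.step1 c (ACGState.init c), q))
    (hN : 0 < p.minIter) (hacc : (acgState O p ξ y₀ c p.minIter).accept p c) :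
    schemeExec O p ξ x₀ y₀ (n + p.minIter) =
      (if ‖c - (acgState O p ξ y₀ c p.minIter).z + (acgState O p ξ y₀ c p.minIter).u‖ ≤
          p.lam * p.rhoHat / 5 then .step3 c (ACGState.init c)
        else .step1 (acgState O p ξ y₀ c p.minIter).z
          (ACGState.init (acgState O p ξ y₀ c p.minIter).z), q + 9 * p.minIter) := by
  obtain ⟨i, hi⟩ := Nat.exists_eq_add_one.2 hN
  have h := schemeExec_step1 hn (i := i) (by omega)
  rw [hi] at hacc ⊢
  rw [← add_assoc, schemeExec, h]
  rw [acgState] at hacc ⊢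
  simp only [schemeStep, run_acgIteration, if_pos hacc]
  split_ifs with hsmall <;>
  · simp only [OracleProg.run]
    rw [Prod.mk.injEq]
    exact ⟨rfl, by ring⟩

lemma schemeExec_step3 (hn : schemeExec O p ξ x₀ y₀ n = (.step3 c (ACGState.init c), q)) {J : ℕ}
    (hJ : ∀ i < J, ¬ ((acgState O p ξ y₀ c i).accept p c ∧
      (acgState O p ξ y₀ c i).eps ≤ p.epsHat * p.lam)) {i : ℕ} (hi : i < J) :
    schemeExec O p ξ x₀ y₀ (n + i) = (.step3 c (acgState O p ξ y₀ c i), q + 9 * i) := by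
  induction i with
  | zero => exact hn
  | succ i ih =>
    rw [← add_assoc, schemeExec, ih (by omega)]
    have hna := hJ (i + 1) hi
    rw [acgState] at hna
    simp only [schemeStep, run_acgIteration, if_neg hna, OracleProg.run, acgState]
    rw [Prod.mk.injEq]
    exact ⟨rfl, by ring⟩

lemma schemeExec_step3_end (hn : schemeExec O p ξ x₀ y₀ n = (.step3 c (ACGState.init c), q))
    {J : ℕ} (hJ0 : 0 < J) (hJ : ∀ i < J, ¬ ((acgState O p ξ y₀ c i).accept p c ∧
      (acgState O p ξ y₀ c i).eps ≤ p.epsHat * p.lam))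
    (hacc : (acgState O p ξ y₀ c J).accept p c ∧
      (acgState O p ξ y₀ c J).eps ≤ p.epsHat * p.lam) :
    schemeExec O p ξ x₀ y₀ (n + J) =
      (((finalStep p ξ y₀ (acgState O p ξ y₀ c J).z).run O).1, q + 9 * J + 7) := by
  obtain ⟨i, rfl⟩ := Nat.exists_eq_add_one.2 hJ0
  have h := schemeExec_step3 hn hJ (i := i) (by omega)
  rw [← add_assoc, schemeExec, h]
  rw [acgState] at hacc ⊢
  simp only [schemeStep, run_acgIteration, if_pos hacc]
  rw [Prod.mk.injEq]
  refine ⟨rfl, ?_⟩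
  simp only [finalStep, evalSmoothed, OracleProg.run]
  ring

variable (O p ξ y₀ x₀) in
/-- The prox centers computed by the program. -/
def proxCenter : ℕ → E
  | 0 => x₀
  | k + 1 => (acgState O p ξ y₀ (proxCenter k) p.minIter).z

variable (O p ξ y₀ x₀) in
/-- The residual tested in step 2 of outer iteration `k + 1`. -/
def outerResidual (k : ℕ) : ℝ :=
  ‖proxCenter O p ξ y₀ x₀ k - (acgState O p ξ y₀ (proxCenter O p ξ y₀ x₀ k) p.minIter).z +
    (acgState O p ξ y₀ (proxCenter O p ξ y₀ x₀ k) p.minIter).u‖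

lemma schemeExec_outer (hN : 0 < p.minIter)
    (hacc : ∀ k, (acgState O p ξ y₀ (proxCenter O p ξ y₀ x₀ k) p.minIter).accept p
      (proxCenter O p ξ y₀ x₀ k)) {k : ℕ}
    (hk : ∀ i < k, ¬ outerResidual O p ξ y₀ x₀ i ≤ p.lam * p.rhoHat / 5) :
    schemeExec O p ξ x₀ y₀ (k * p.minIter) =
      (.step1 (proxCenter O p ξ y₀ x₀ k) (ACGState.init (proxCenter O p ξ y₀ x₀ k)),
        9 * (k * p.minIter)) := by
  induction k with
  | zero => simp [schemeExec, proxCenter]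
  | succ k ih =>
    have h := schemeExec_step1_end (ih fun i hi => hk i (by omega)) hN (hacc k)
    have hk' := hk k (by omega)
    unfold outerResidual at hk'
    rw [add_mul, one_mul, h, if_neg hk', mul_add]
    rfl

end ProgramStates

/-! ### The program computes the sequences of the method. -/

section ProxH

lemma IsArgmin.of_mul_add {Z : Type*} [NormedAddCommGroup Z] {S : Set Z} {φ φ' : Z → ℝ} {z : Z}
    (hz : IsArgmin S φ z) {κ b : ℝ} (hκ : 0 ≤ κ) (h : ∀ v, φ' v = κ * φ v + b) :
    IsArgmin S φ' z := by
  refine ⟨hz.1, fun v hv => ?_⟩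
  have h1 : φ z ≤ φ v := hz.2 hv
  have h2 := mul_le_mul_of_nonneg_left h1 hκ
  change φ' z ≤ φ' v
  rw [h, h]
  linarith

variable {E F : Type*} [NormedAddCommGroup E] [InnerProductSpace ℝ E] [CompleteSpace E]
  [NormedAddCommGroup F] {P : MinMaxProblem E F} {O : Oracle E F}

/-- The minimizer of `⟨β, ·⟩ + a h + (κ / 2) ‖· - c‖²` is one evaluation of the `h`-resolvent. -/
lemma MinMaxProblem.IsOracle.isArgmin_proxH (hO : P.IsOracle O) {a κ : ℝ} (ha : 0 < a) (hκ : 0 < κ) (c β : E)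
    {φ : E → ℝ} {b : ℝ}
    (hφ : ∀ v, φ v = inner ℝ β v + a * P.h v + κ / 2 * ‖v - c‖ ^ 2 + b) :
    IsArgmin P.X φ (O.proxH (a / κ) (c - κ⁻¹ • β)) := by
  refine (hO.proxH_spec (a / κ) (by positivity) (c - κ⁻¹ • β)).of_mul_add
    (b := b + inner ℝ β c - κ / 2 * ‖κ⁻¹ • β‖ ^ 2) hκ.le fun v => ?_
  have e : v - (c - κ⁻¹ • β) = (v - c) + κ⁻¹ • β := by abel
  rw [hφ, e, norm_add_sq_real, inner_smul_right, inner_sub_left, real_inner_comm v β,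
    real_inner_comm c β]
  field_simp
  ring

end ProxH

section Correctness

variable {E F : Type*} [NormedAddCommGroup E] [InnerProductSpace ℝ E] [CompleteSpace E]
  [NormedAddCommGroup F]
  {P : MinMaxProblem E F} {m Lx Ly ξ : ℝ} {y₀ : F} {O : Oracle E F} {p : AIPPParams}
  {x₀ : E}

namespace MinMaxProblem

section Trace

variable (hO : P.IsOracle O)
  (hS : AIPPSetting P.X (P.pXi ξ y₀) P.h p m) {c : E} (hc : c ∈ P.X)

include hS in
-- The oracle is specified only for points of `X`, so the iterates must be placed in `X` before the
-- trace can be recognized as an ACG trace. This is why some facts about `A` are proved again for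
-- program states.
lemma acgState_A_nonneg (j : ℕ) : 0 ≤ (acgState O p ξ y₀ c j).A := by
  have hL := hS.acgL_pos
  have hμ : 0 < p.acgMu := by norm_num [AIPPParams.acgMu]
  induction j with
  | zero => exact le_rfl
  | succ j ih =>
    change 0 ≤ (acgState O p ξ y₀ c j).A + _ / _
    positivity

include hS in
lemma acgState_A_lt_succ (j : ℕ) :
    (acgState O p ξ y₀ c j).A < (acgState O p ξ y₀ c (j + 1)).A := by
  have hL := hS.acgL_pos
  have hμ : 0 < p.acgMu := by norm_num [AIPPParams.acgMu]
  have hA := acgState_A_nonneg hS (O := O) (c := c) j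
  change _ < (acgState O p ξ y₀ c j).A + _ / _
  rw [lt_add_iff_pos_right]
  positivity

include hS in
lemma acgState_combo_mem (j : ℕ) {a b : E} (ha : a ∈ P.X) (hb : b ∈ P.X) :
    ((acgState O p ξ y₀ c j).A / (acgState O p ξ y₀ c (j + 1)).A) • a +
      (((acgState O p ξ y₀ c (j + 1)).A - (acgState O p ξ y₀ c j).A) /
        (acgState O p ξ y₀ c (j + 1)).A) • b ∈ P.X := by
  have h1 := acgState_A_nonneg hS (O := O) (c := c) j
  have h2 := acgState_A_lt_succ hS (O := O) (c := c) j
  have h3 := h1.trans_lt h2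
  exact hS.convexOn.1 ha hb (by positivity) (div_nonneg (sub_nonneg.2 h2.le) h3.le)
    (by field_simp; ring)

include hO hS hc

lemma acgState_y_mem (j : ℕ) : (acgState O p ξ y₀ c j).y ∈ P.X := by
  cases j with
  | zero => exact hc
  | succ j =>
    have h2 := acgState_A_lt_succ hS (O := O) (c := c) j
    have h3 := (acgState_A_nonneg hS (O := O) (c := c) j).trans_lt h2
    refine (hO.proxH_spec (p.lam / (1 / 2 + 1 / (acgState O p ξ y₀ c (j + 1)).A)) ?_ _).1
    have := hS.lam_pos
    positivity

lemma acgState_z_mem (j : ℕ) : (acgState O p ξ y₀ c j).z ∈ P.X := by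
  induction j with
  | zero => exact hc
  | succ j ih => exact acgState_combo_mem hS j ih (acgState_y_mem hO hS hc (j + 1))

end Trace

lemma proxCenter_mem (hO : P.IsOracle O)
    (hS : AIPPSetting P.X (P.pXi ξ y₀) P.h p m) (hx₀ : x₀ ∈ P.X) (k : ℕ) : proxCenter O p ξ y₀ x₀ k ∈ P.X := by
  induction k with
  | zero => exact hx₀
  | succ k ih => exact acgState_z_mem hO hS ih _

variable [InnerProductSpace ℝ F]

/-- The resolvent maximizes `ξ Φ_ξ(x, ·)`, whose maximizer is unique. -/
lemma IsOracle.proxPhi_eq (hO : P.IsOracle O) (hP : P.Assumptions m Lx Ly) (hξ : 0 < ξ) {x : E}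
    (hx : x ∈ P.X) (y₀ : F) : O.proxPhi ξ x y₀ = P.yXi ξ y₀ x := by
  obtain ⟨Ω, hΩ⟩ := hP.exists_smoothOn
  refine hΩ.argmax_unique hξ hP.Y_compact (hΩ.subset hx) ?_
  have h := hO.proxPhi_spec ξ hξ x hx y₀
  refine ⟨h.1, fun y hy => ?_⟩
  have h1 : ξ * P.Phi x y - 1 / 2 * ‖y - y₀‖ ^ 2 ≤
    ξ * P.Phi x (O.proxPhi ξ x y₀) - 1 / 2 * ‖O.proxPhi ξ x y₀ - y₀‖ ^ 2 := h.2 hy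
  have e : ∀ y, P.PhiXi ξ y₀ x y = ξ⁻¹ * (ξ * P.Phi x y - 1 / 2 * ‖y - y₀‖ ^ 2) := fun y => by
    simp only [PhiXi]
    field_simp
  change P.PhiXi ξ y₀ x y ≤ P.PhiXi ξ y₀ x (O.proxPhi ξ x y₀)
  rw [e, e]
  exact mul_le_mul_of_nonneg_left h1 (by positivity)

lemma IsOracle.smoothed_value (hO : P.IsOracle O) (hP : P.Assumptions m Lx Ly) (hξ : 0 < ξ)
    {x : E} (hx : x ∈ P.X) (y₀ : F) : O.phi x (O.proxPhi ξ x y₀) -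
      1 / (2 * ξ) * ‖O.proxPhi ξ x y₀ - y₀‖ ^ 2 = P.pXi ξ y₀ x := by
  obtain ⟨Ω, hΩ⟩ := hP.exists_smoothOn
  rw [hO.proxPhi_eq hP hξ hx, hO.phi_eq x hx _ (hP.yXi_mem hx),
    hΩ.pXi_eq hP.Y_compact (hΩ.subset hx)]
  rfl

lemma IsOracle.smoothed_gradient (hO : P.IsOracle O) (hP : P.Assumptions m Lx Ly) (hξ : 0 < ξ)
    {x : E} (hx : x ∈ P.X) (y₀ : F) :
    O.gradPhi x (O.proxPhi ξ x y₀) = gradient (P.pXi ξ y₀) x := by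
  rw [hO.proxPhi_eq hP hξ hx, hO.gradPhi_eq x hx _ (hP.yXi_mem hx), hP.gradient_pXi hξ hx]

section Trace

variable (hO : P.IsOracle O) (hP : P.Assumptions m Lx Ly) (hξ : 0 < ξ)
  (hS : AIPPSetting P.X (P.pXi ξ y₀) P.h p m) {c : E} (hc : c ∈ P.X)

include hO hP hξ hS hc

/-- The program computes the sequences generated by the ACG method. -/
lemma isACG_programTrace :
    IsACG P.X (fun v => p.lam * P.pXi ξ y₀ v + 1 / 4 * ‖v - c‖ ^ 2)
      (fun v => p.lam * P.h v + 1 / 4 * ‖v - c‖ ^ 2) p.acgMu p.acgL c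
      (programTrace O p ξ y₀ c) := by
  have hzt : ∀ j, (programTrace O p ξ y₀ c).ztil j ∈ P.X := fun j =>
    acgState_combo_mem hS j (acgState_z_mem hO hS hc j) (acgState_y_mem hO hS hc j)
  have hbeta : ∀ j, (acgState O p ξ y₀ c (j + 1)).beta =
      ((acgState O p ξ y₀ c j).A / (acgState O p ξ y₀ c (j + 1)).A) •
        (acgState O p ξ y₀ c j).beta +
      (((acgState O p ξ y₀ c (j + 1)).A - (acgState O p ξ y₀ c j).A) /
        (acgState O p ξ y₀ c (j + 1)).A) •
        gradient (fun v => p.lam * P.pXi ξ y₀ v + 1 / 4 * ‖v - c‖ ^ 2)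
          ((programTrace O p ξ y₀ c).ztil j) := fun j => by
    rw [hS.gradient_smoothPart c (hzt j), ← hO.smoothed_gradient hP hξ (hzt j) y₀]
    rfl
  have halpha : ∀ j, (acgState O p ξ y₀ c (j + 1)).alpha =
      (acgState O p ξ y₀ c j).A / (acgState O p ξ y₀ c (j + 1)).A *
        (acgState O p ξ y₀ c j).alpha +
      ((acgState O p ξ y₀ c (j + 1)).A - (acgState O p ξ y₀ c j).A) /
        (acgState O p ξ y₀ c (j + 1)).A *
        (p.lam * P.pXi ξ y₀ ((programTrace O p ξ y₀ c).ztil j) +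
          1 / 4 * ‖(programTrace O p ξ y₀ c).ztil j - c‖ ^ 2 -
        inner ℝ (gradient (fun v => p.lam * P.pXi ξ y₀ v + 1 / 4 * ‖v - c‖ ^ 2)
          ((programTrace O p ξ y₀ c).ztil j)) ((programTrace O p ξ y₀ c).ztil j)) := fun j => by
    rw [hS.gradient_smoothPart c (hzt j), ← hO.smoothed_gradient hP hξ (hzt j) y₀,
      ← hO.smoothed_value hP hξ (hzt j) y₀]
    rfl
  -- Fields that only repeat the arithmetic of the program hold by `rfl`; oracle answers have to be
  -- identified only in `Γ`, `y` and `ε`.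
  refine
    { A_zero := rfl
      y_zero := rfl
      z_zero := rfl
      Gam_zero := fun v => by
        change (0 : ℝ) + inner ℝ (0 : E) v = 0
        simp
      A_succ := fun j => rfl
      ztil_eq := fun j => rfl
      Gam_succ := fun j v => ?_
      y_succ := fun j => ?_
      z_succ := fun j => rfl
      u_succ := fun j => rfl
      eps_succ := fun j => ?_ }
  · change (acgState O p ξ y₀ c (j + 1)).alpha + inner ℝ (acgState O p ξ y₀ c (j + 1)).beta v =
      (acgState O p ξ y₀ c j).A / (acgState O p ξ y₀ c (j + 1)).A *
        ((acgState O p ξ y₀ c j).alpha + inner ℝ (acgState O p ξ y₀ c j).beta v) +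
      ((acgState O p ξ y₀ c (j + 1)).A - (acgState O p ξ y₀ c j).A) /
        (acgState O p ξ y₀ c (j + 1)).A * _
    rw [hbeta, halpha, inner_add_left, inner_smul_left, inner_smul_left, inner_sub_right]
    simp only [conj_trivial]
    ring
  · have h2 := acgState_A_lt_succ hS (O := O) (c := c) j
    have h3 := (acgState_A_nonneg hS (O := O) (c := c) j).trans_lt h2
    refine hO.isArgmin_proxH (b := (acgState O p ξ y₀ c (j + 1)).alpha)
      (κ := 1 / 2 + 1 / (acgState O p ξ y₀ c (j + 1)).A) hS.lam_pos (by positivity) c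
      (acgState O p ξ y₀ c (j + 1)).beta fun v => ?_
    change (acgState O p ξ y₀ c (j + 1)).alpha + inner ℝ (acgState O p ξ y₀ c (j + 1)).beta v +
      (p.lam * P.h v + 1 / 4 * ‖v - c‖ ^ 2) +
      1 / (2 * (acgState O p ξ y₀ c (j + 1)).A) * ‖v - c‖ ^ 2 = _
    field_simp
    ring
  · have hz := acgState_z_mem hO hS hc (j + 1)
    have hy := acgState_y_mem hO hS hc (j + 1)
    change _ = (p.lam * P.pXi ξ y₀ (acgState O p ξ y₀ c (j + 1)).z +
      1 / 4 * ‖(acgState O p ξ y₀ c (j + 1)).z - c‖ ^ 2 +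
      (p.lam * P.h (acgState O p ξ y₀ c (j + 1)).z +
      1 / 4 * ‖(acgState O p ξ y₀ c (j + 1)).z - c‖ ^ 2)) - _ -
      (p.lam * P.h (acgState O p ξ y₀ c (j + 1)).y +
      1 / 4 * ‖(acgState O p ξ y₀ c (j + 1)).y - c‖ ^ 2) - _
    rw [← hO.smoothed_value hP hξ hz y₀, ← hO.hval_eq _ hz, ← hO.hval_eq _ hy]
    rfl

lemma proxIterate_acgState {j : ℕ} (hj : p.minIter ≤ j) :
    ProxIterate P.X (fun v => P.pXi ξ y₀ v + P.h v) p c (acgState O p ξ y₀ c j).z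
      (acgState O p ξ y₀ c j).u (acgState O p ξ y₀ c j).eps :=
  hS.proxIterate hc (isACG_programTrace hO hP hξ hS hc) hj

lemma accept_acgState {j : ℕ} (hj : p.minIter ≤ j) : (acgState O p ξ y₀ c j).accept p c := by
  refine ⟨by rwa [acgState_j], ?_⟩
  rw [hS.sigma_eq]
  exact (proxIterate_acgState hO hP hξ hS hc hj).relative_error

end Trace

end MinMaxProblem

end Correctness

end

end MinMaxSmoothing

namespace MinMaxSmoothing

/-! ### Iteration counts and termination. -/

section Complexity

variable {E F : Type*} [NormedAddCommGroup E] [InnerProductSpace ℝ E] [CompleteSpace E]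
  [NormedAddCommGroup F] [InnerProductSpace ℝ F]
  {P : MinMaxProblem E F} {m Lx Ly ξ : ℝ} {y₀ : F} {O : Oracle E F} {p : AIPPParams} {x₀ : E}

namespace MinMaxProblem

section Outer

variable (hO : P.IsOracle O) (hP : P.Assumptions m Lx Ly) (hξ : 0 < ξ)
  (hS : AIPPSetting P.X (P.pXi ξ y₀) P.h p m)

include hO hP hξ hS

lemma outer_descent (hx₀ : x₀ ∈ P.X) (k : ℕ) :
    p.lam * (P.pXi ξ y₀ (proxCenter O p ξ y₀ x₀ (k + 1)) + P.h (proxCenter O p ξ y₀ x₀ (k + 1))) +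
        1 / 4 * outerResidual O p ξ y₀ x₀ k ^ 2 ≤
      p.lam * (P.pXi ξ y₀ (proxCenter O p ξ y₀ x₀ k) + P.h (proxCenter O p ξ y₀ x₀ k)) := by
  have hc := proxCenter_mem hO hS hx₀ k
  exact (proxIterate_acgState hO hP hξ hS hc le_rfl).descent hc

/-- The bound on the number of outer iterations that do not pass the test of step 2. -/
lemma outer_count (hx₀ : x₀ ∈ P.X) {δ b : ℝ} (hδ : 0 ≤ δ)
    (hb : ∀ x ∈ P.X, b ≤ p.lam * (P.pXi ξ y₀ x + P.h x)) {n : ℕ}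
    (hn : ∀ i < n, ¬ outerResidual O p ξ y₀ x₀ i ≤ δ) {x : E} (hx : x ∈ P.X) :
    ((n : ℝ) - 1) * (δ ^ 2 / 4) ≤
      p.lam * (P.pXi ξ y₀ x + P.h x) - b + 5 / 9 * ‖x - x₀‖ ^ 2 := by
  cases n with
  | zero =>
    have := hb x hx
    push_cast
    nlinarith [sq_nonneg δ, sq_nonneg ‖x - x₀‖]
  -- The first outer step is reserved for the comparison with `x`; the remaining `n` decreases
  -- telescope, hence the `- 1` in the statement.
  | succ n =>
    have hsum : p.lam * (P.pXi ξ y₀ (proxCenter O p ξ y₀ x₀ (n + 1)) +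
        P.h (proxCenter O p ξ y₀ x₀ (n + 1))) + n * (δ ^ 2 / 4) ≤
        p.lam * (P.pXi ξ y₀ (proxCenter O p ξ y₀ x₀ 1) + P.h (proxCenter O p ξ y₀ x₀ 1)) := by
      induction n with
      | zero => simp
      | succ n ih =>
        have h1 := ih fun i hi => hn i (by omega)
        have h2 := outer_descent hO hP hξ hS hx₀ (n + 1)
        have h3 := pow_le_pow_left₀ hδ (not_le.1 (hn (n + 1) (by omega))).le 2
        push_cast
        linarith
    have h1 := hb _ (proxCenter_mem hO hS hx₀ (n + 1))
    have h2 := (proxIterate_acgState hO hP hξ hS hx₀ le_rfl).le_add_dist_sq hx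
    change p.lam * (P.pXi ξ y₀ (proxCenter O p ξ y₀ x₀ 1) + P.h (proxCenter O p ξ y₀ x₀ 1)) ≤
      _ at h2
    push_cast
    linarith

lemma exists_outerResidual_le (hx₀ : x₀ ∈ P.X) {δ b : ℝ} (hδ : 0 < δ)
    (hb : ∀ x ∈ P.X, b ≤ p.lam * (P.pXi ξ y₀ x + P.h x)) :
    ∃ k, outerResidual O p ξ y₀ x₀ k ≤ δ := by
  by_contra! hcon
  obtain ⟨n, hn⟩ := exists_nat_gt ((p.lam * (P.pXi ξ y₀ x₀ + P.h x₀) - b +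
    5 / 9 * ‖x₀ - x₀‖ ^ 2) / (δ ^ 2 / 4) + 1)
  have h := outer_count hO hP hξ hS hx₀ hδ.le hb (n := n) (fun i _ => not_le.2 (hcon i)) hx₀
  rw [← le_div_iff₀ (by positivity)] at h
  linarith

/-- The number of iterations of the ACG call of step 3. -/
lemma exists_step3_index {c : E} (hc : c ∈ P.X)
    (hsmall : ‖c - (acgState O p ξ y₀ c p.minIter).z + (acgState O p ξ y₀ c p.minIter).u‖ ≤
      p.lam * p.rhoHat / 5) :
    ∃ J ≤ p.minIter + ⌈4 * √(2 * p.lam * p.M + 1) * Real.log √(2 * p.lam * p.M + 1)⌉₊,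
      (acgState O p ξ y₀ c J).accept p c ∧ (acgState O p ξ y₀ c J).eps ≤ p.epsHat * p.lam := by
  have hT := isACG_programTrace hO hP hξ hS hc
  have hlM := hS.lam_mul_M_pos
  have hs2 : √(2 * p.lam * p.M + 1) ^ 2 = 2 * p.lam * p.M + 1 :=
    Real.sq_sqrt (by rw [mul_assoc]; positivity)
  have hs1 : 1 ≤ √(2 * p.lam * p.M + 1) := by
    rw [Real.one_le_sqrt, mul_assoc]; linarith
  have hgrow := hS.pow_le_A hT (le_refl p.minIter)
    ⌈4 * √(2 * p.lam * p.M + 1) * Real.log √(2 * p.lam * p.M + 1)⌉₊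
  set i := ⌈4 * √(2 * p.lam * p.M + 1) * Real.log √(2 * p.lam * p.M + 1)⌉₊ with hi_def
  refine ⟨p.minIter + i, le_rfl, accept_acgState hO hP hξ hS hc (Nat.le_add_right _ _),
    hS.eps_le_epsHat hc hT le_rfl (Nat.le_add_right _ _) hsmall (le_trans ?_ hgrow)⟩
  have hi := Nat.le_ceil (4 * √(2 * p.lam * p.M + 1) * Real.log √(2 * p.lam * p.M + 1))
  rw [← hi_def] at hi
  set s := √(2 * p.lam * p.M + 1)
  rw [← hs2]
  have hs0 : 0 < s := by linarith
  -- `log(1 + 1/s) ≥ 1/(s + 1) ≥ 1/(2s)`, so the exponent `4 s log s` lifts the geometric lower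
  -- bound to `s² = 2λM + 1`, the value required by `eps_le_epsHat`.
  have hlog : 1 / (2 * s) ≤ Real.log (1 + 1 / s) := by
    refine le_trans ?_ (Real.one_sub_inv_le_log_of_pos (by positivity))
    have e : 1 - (1 + 1 / s)⁻¹ = 1 / (s + 1) := by field_simp; ring
    rw [e]
    exact one_div_le_one_div_of_le (by positivity) (by linarith)
  rw [← Real.log_le_log_iff (by positivity) (by positivity), Real.log_pow, Real.log_pow]
  have h1 := mul_le_mul hi hlog (by positivity) (by positivity)
  have e : 4 * s * Real.log s * (1 / (2 * s)) = 2 * Real.log s := by field_simp; ring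
  push_cast
  linarith

/-- The program halts, its output is the output of a run of the AIPP method, and the number of
oracle evaluations is determined by the number `K` of rejected outer iterations and the number `J`
of iterations of step 3. -/
lemma exists_halted (hx₀ : x₀ ∈ P.X)
    (hsmall : ∃ k, outerResidual O p ξ y₀ x₀ k ≤ p.lam * p.rhoHat / 5) :
    ∃ (K J n : ℕ) (x u : E),
      schemeExec O p ξ x₀ y₀ n = (.halted x u, 9 * ((K + 1) * p.minIter) + 9 * J + 7) ∧
      (∃ T : AIPPTrace E, IsAIPPRun P.X (P.pXi ξ y₀) P.h p x₀ T ∧ x = T.xbar ∧ u = T.ubar) ∧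
      (∀ i < K, ¬ outerResidual O p ξ y₀ x₀ i ≤ p.lam * p.rhoHat / 5) ∧
      J ≤ p.minIter + ⌈4 * √(2 * p.lam * p.M + 1) * Real.log √(2 * p.lam * p.M + 1)⌉₊ := by
  classical
  obtain ⟨K, hK, hKmin⟩ : ∃ K, outerResidual O p ξ y₀ x₀ K ≤ p.lam * p.rhoHat / 5 ∧
      ∀ i < K, ¬ outerResidual O p ξ y₀ x₀ i ≤ p.lam * p.rhoHat / 5 :=
    ⟨Nat.find hsmall, Nat.find_spec hsmall, fun i hi => Nat.find_min hsmall hi⟩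
  have hmem := proxCenter_mem hO hS hx₀
  have hN := hS.minIter_pos
  obtain ⟨J₀, hJ₀, hJ₀'⟩ := exists_step3_index hO hP hξ hS (hmem K) hK
  obtain ⟨J, hJ, hJmin, hJle⟩ : ∃ J, ((acgState O p ξ y₀ (proxCenter O p ξ y₀ x₀ K) J).accept p
      (proxCenter O p ξ y₀ x₀ K) ∧
      (acgState O p ξ y₀ (proxCenter O p ξ y₀ x₀ K) J).eps ≤ p.epsHat * p.lam) ∧
      (∀ i < J, ¬ ((acgState O p ξ y₀ (proxCenter O p ξ y₀ x₀ K) i).accept p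
        (proxCenter O p ξ y₀ x₀ K) ∧
        (acgState O p ξ y₀ (proxCenter O p ξ y₀ x₀ K) i).eps ≤ p.epsHat * p.lam)) ∧ J ≤ J₀ :=
    have hex := Exists.intro (p := fun J => (acgState O p ξ y₀ (proxCenter O p ξ y₀ x₀ K) J).accept p
      (proxCenter O p ξ y₀ x₀ K) ∧
      (acgState O p ξ y₀ (proxCenter O p ξ y₀ x₀ K) J).eps ≤ p.epsHat * p.lam) J₀ hJ₀'
    ⟨Nat.find hex, Nat.find_spec hex, fun i hi => Nat.find_min hex hi, Nat.find_min' hex hJ₀'⟩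
  have hNJ : p.minIter ≤ J := by
    have := hJ.1.1
    rwa [acgState_j] at this
  have hexec := schemeExec_outer hN (fun k => accept_acgState hO hP hξ hS (hmem k) le_rfl) hKmin
  have hexec' := schemeExec_step1_end hexec hN (accept_acgState hO hP hξ hS (hmem K) le_rfl)
  have hK' := hK
  unfold outerResidual at hK'
  rw [if_pos hK'] at hexec'
  have hexec3 := schemeExec_step3_end hexec' (hN.trans_le hNJ) hJmin hJ
  rw [finalStep_run] at hexec3
  have hzJ := acgState_z_mem hO hS (hmem K) J
  have hMl : 0 < p.Mlam := by
    have := hS.M_pos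
    have := hS.lam_pos
    unfold AIPPParams.Mlam
    positivity
  set z := (acgState O p ξ y₀ (proxCenter O p ξ y₀ x₀ K) J).z with hz_def
  set xbar := O.proxH (1 / p.Mlam) (z - p.Mlam⁻¹ • O.gradPhi z (O.proxPhi ξ z y₀)) with hxbar_def
  set ubar := p.Mlam • (z - xbar) + O.gradPhi xbar (O.proxPhi ξ xbar y₀) -
    O.gradPhi z (O.proxPhi ξ z y₀) with hubar_def
  have hxbar : xbar ∈ P.X := (hO.proxH_spec _ (by positivity) _).1
  refine ⟨K, J, _, xbar, ubar, hexec3.trans ?_, ⟨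
    { K := K + 1
      x := proxCenter O p ξ y₀ x₀
      acg := fun k => programTrace O p ξ y₀ (proxCenter O p ξ y₀ x₀ (k - 1))
      j := fun _ => p.minIter
      jFinal := J
      xbar := xbar
      ubar := ubar }, ?_, rfl, rfl⟩, hKmin, hJle.trans hJ₀⟩
  · rw [Prod.mk.injEq]
    exact ⟨rfl, by ring⟩
  · refine
      { one_le_K := Nat.le_add_left _ _
        x_zero := rfl
        acg_call := fun k _ _ => isACG_programTrace hO hP hξ hS (hmem _)
        step1 := fun k _ _ => ⟨⟨le_rfl,
          (proxIterate_acgState hO hP hξ hS (hmem _) le_rfl).inexactProx hS.sigma_eq⟩,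
          fun i hi => hi.1⟩
        step2_continue := fun k hk1 hk => ?_
        step2_stop := hK
        step3 := ⟨⟨hNJ, (proxIterate_acgState hO hP hξ hS (hmem _) hNJ).inexactProx hS.sigma_eq,
          hJ.2⟩, fun i hi => not_lt.1 fun hlt =>
            hJmin i hlt ⟨accept_acgState hO hP hξ hS (hmem _) hi.1, hi.2.2⟩⟩
        step4_xbar := ?_
        step4_ubar := ?_ }
    · obtain ⟨k, rfl⟩ := Nat.exists_eq_add_one.2 hk1
      exact ⟨hKmin k (by simpa using hk), rfl⟩
    · change IsArgmin P.X (fun v => inner ℝ (gradient (P.pXi ξ y₀) z) (v - z) + P.h v +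
        p.Mlam / 2 * ‖v - z‖ ^ 2) xbar
      rw [hxbar_def, hO.smoothed_gradient hP hξ hzJ]
      refine hO.isArgmin_proxH (b := - inner ℝ (gradient (P.pXi ξ y₀) z) z) one_pos hMl _ _
        fun v => ?_
      rw [inner_sub_right]
      ring
    · change ubar = p.Mlam • (z - xbar) + gradient (P.pXi ξ y₀) xbar - gradient (P.pXi ξ y₀) z
      rw [hubar_def, hO.smoothed_gradient hP hξ hzJ, hO.smoothed_gradient hP hξ hxbar]

end Outer

end MinMaxProblem

end Complexity

end MinMaxSmoothing

namespace MinMaxSmoothing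

/-! ### From iteration counts to the stated bounds. -/

section Arithmetic

variable {m Lx Ly ξ : ℝ}

lemma one_le_OmegaXi (hLy : 0 ≤ Ly) : 1 ≤ OmegaXi m Lx Ly ξ := by
  have : 0 ≤ (√ξ * Ly + √Lx) / √m := by positivity
  unfold OmegaXi
  linarith

lemma one_le_logOnePlus (t : ℝ) : 1 ≤ logOnePlus t := le_max_left _ _

/-- As `m ≤ Lx`, the root in `L_ξ` is at most `2 √ξ √Lx`, which completes a perfect square. -/
lemma Lxi_le_sq (hm : 0 < m) (hmL : m ≤ Lx) (hLy : 0 ≤ Ly) (hξ : 0 < ξ) :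
    Lxi m Lx Ly ξ ≤ (√ξ * Ly + √Lx) ^ 2 := by
  have hLx := hm.trans_le hmL
  have h1 := Real.sq_sqrt hξ.le
  have h2 := Real.sq_sqrt hLx.le
  have h3 : √(ξ * (Lx + m)) ≤ √ξ * (2 * √Lx) := by
    rw [Real.sqrt_le_left (by positivity), mul_pow, mul_pow, h1, h2]
    nlinarith
  have h4 := mul_le_mul_of_nonneg_left h3 hLy
  have e : (√ξ * Ly + √Lx) ^ 2 = ξ * Ly ^ 2 + Ly * (√ξ * (2 * √Lx)) + Lx := by
    linear_combination Ly ^ 2 * h1 + h2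
  rw [e]
  unfold Lxi Qxi
  linarith

/-- For `t = Ω_ξ - 1`, the radicand is `L_ξ / (2m) + 1 ≤ t² + 1 ≤ (1 + t)²`. -/
lemma sqrt_le_OmegaXi (hm : 0 < m) (hmL : m ≤ Lx) (hLy : 0 ≤ Ly) (hξ : 0 < ξ) :
    √(2 * (1 / (4 * m)) * Lxi m Lx Ly ξ + 1) ≤ OmegaXi m Lx Ly ξ := by
  have h1 := Lxi_le_sq hm hmL hLy hξ
  rw [Real.sqrt_le_left (zero_le_one.trans (one_le_OmegaXi hLy))]
  have ht : 0 ≤ (√ξ * Ly + √Lx) / √m := by positivity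
  have h2 : ((√ξ * Ly + √Lx) / √m) ^ 2 = (√ξ * Ly + √Lx) ^ 2 / m := by
    rw [div_pow, Real.sq_sqrt hm.le]
  have h3 : 2 * (1 / (4 * m)) * Lxi m Lx Ly ξ ≤ (√ξ * Ly + √Lx) ^ 2 / m := by
    rw [le_div_iff₀ hm]
    have e : 2 * (1 / (4 * m)) * Lxi m Lx Ly ξ * m = Lxi m Lx Ly ξ / 2 := by field_simp; norm_num
    rw [e]
    nlinarith [sq_nonneg (√ξ * Ly + √Lx)]
  unfold OmegaXi
  nlinarith

/-- Assembles the count of oracle evaluations from the bounds on the number of iterations. -/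
lemma evaluations_le {s Ω Q : ℝ} (hs : 1 ≤ s) (hsΩ : s ≤ Ω) {K J : ℕ} (hK : (K : ℝ) - 1 ≤ Q)
    (hQ : 0 ≤ Q) (hJ : J ≤ ⌈6 * s⌉₊ + ⌈4 * s * Real.log s⌉₊) :
    ((9 * ((K + 1) * ⌈6 * s⌉₊) + 9 * J + 7 : ℕ) : ℝ) ≤ Ω * (63 * Q + 241 * logOnePlus Ω) := by
  have hΩ : 1 ≤ Ω := hs.trans hsΩ
  have hl := one_le_logOnePlus Ω
  have hlog : Real.log s ≤ logOnePlus Ω :=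
    (Real.log_le_log (by linarith) hsΩ).trans (le_max_right _ _)
  have hlog0 := Real.log_nonneg hs
  have hN := (Nat.ceil_lt_add_one (show 0 ≤ 6 * s by positivity)).le
  have hi := (Nat.ceil_lt_add_one (show 0 ≤ 4 * s * Real.log s by positivity)).le
  have hJ' : (J : ℝ) ≤ ⌈6 * s⌉₊ + ⌈4 * s * Real.log s⌉₊ := by exact_mod_cast hJ
  have hN' : (⌈6 * s⌉₊ : ℝ) ≤ 7 * Ω := by linarith
  have hsl : s * Real.log s ≤ Ω * logOnePlus Ω := mul_le_mul hsΩ hlog hlog0 (by linarith)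
  have hKN : ((K : ℝ) + 1) * ⌈6 * s⌉₊ ≤ (Q + 2) * (7 * Ω) :=
    mul_le_mul (by linarith) hN' (by positivity) (by linarith)
  have hΩl : Ω ≤ Ω * logOnePlus Ω := le_mul_of_one_le_right (by linarith) hl
  -- `63 = 9 · 7`, and `241 = 126 + 63 + 36 + 16`: two outer calls, the two parts of `J`, and the
  -- additive constants `9 + 7`.
  push_cast
  nlinarith

/-- The growth of `Ω_ξ` for `ξ = D / ρ`. -/
lemma OmegaXi_div_le {D ρ : ℝ} (hρ : 0 < ρ) (hρ1 : ρ ≤ 1) :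
    OmegaXi m Lx Ly (D / ρ) ≤ ρ ^ (-(1 / 2) : ℝ) * OmegaXi m Lx Ly D := by
  have hr : ρ ^ (-(1 / 2) : ℝ) = (√ρ)⁻¹ := by
    rw [Real.rpow_neg hρ.le, Real.sqrt_eq_rpow]
  have hr1 : 1 ≤ (√ρ)⁻¹ :=
    (one_le_inv₀ (Real.sqrt_pos.2 hρ)).2 (Real.sqrt_le_one.2 hρ1)
  rw [hr]
  unfold OmegaXi
  rw [Real.sqrt_div' _ hρ.le, div_eq_mul_inv √D]
  have h1 : √Lx ≤ (√ρ)⁻¹ * √Lx := le_mul_of_one_le_left (Real.sqrt_nonneg _) hr1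
  have h2 : (√D * (√ρ)⁻¹ * Ly + √Lx) / √m ≤ (√ρ)⁻¹ * ((√D * Ly + √Lx) / √m) := by
    rw [← mul_div_assoc]
    gcongr
    linarith
  linarith

/-- `Ω_ξ` contributes `ρy^(-1/2)`, the smoothing term becomes `m D ρy / ρx²`, and `log Ω_ξ` exceeds
a constant by at most `log(1/ρy) / 2`, which the hypothesis on `B` absorbs into `ρx^(-2)`. -/
lemma complexity_div_le {D ρx ρy R B : ℝ} (hm : 0 < m) (hLy : 0 ≤ Ly) (hD : 0 < D)
    (hρx : 0 < ρx) (hρx1 : ρx ≤ 1) (hρy : 0 < ρy) (hρy1 : ρy ≤ 1) (hR : 0 ≤ R)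
    (hB : Real.log (1 / ρy) ≤ B / ρx ^ 2) :
    OmegaXi m Lx Ly (D / ρy) * (m ^ 2 * R / ρx ^ 2 + m * D ^ 2 / (D / ρy * ρx ^ 2) +
        logOnePlus (OmegaXi m Lx Ly (D / ρy))) ≤
      OmegaXi m Lx Ly D * (m ^ 2 * R + m * D + (1 + Real.log (OmegaXi m Lx Ly D) + |B|)) *
        (ρx ^ (-2 : ℝ) * ρy ^ (-(1 / 2) : ℝ)) := by
  have h0 := OmegaXi_div_le (m := m) (Lx := Lx) (Ly := Ly) (D := D) hρy hρy1
  have hΩ1 := one_le_OmegaXi (m := m) (Lx := Lx) (ξ := D) hLy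
  have hΩ := one_le_OmegaXi (m := m) (Lx := Lx) (ξ := D / ρy) hLy
  have hrpos : 0 < ρy ^ (-(1 / 2) : ℝ) := Real.rpow_pos_of_pos hρy _
  have hrx : ρx ^ (-2 : ℝ) = 1 / ρx ^ 2 := by
    rw [Real.rpow_neg hρx.le, Real.rpow_two, one_div]
  have hρ2 : ρx ^ 2 ≤ 1 := pow_le_one₀ hρx.le hρx1
  have hlog1 := Real.log_nonneg hΩ1
  have hl : logOnePlus (OmegaXi m Lx Ly (D / ρy)) ≤
      (1 + Real.log (OmegaXi m Lx Ly D) + |B|) / ρx ^ 2 := by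
    rw [le_div_iff₀ (by positivity)]
    have hlogr : Real.log (OmegaXi m Lx Ly (D / ρy)) ≤
        1 / 2 * Real.log (1 / ρy) + Real.log (OmegaXi m Lx Ly D) := by
      refine (Real.log_le_log (by linarith) h0).trans_eq ?_
      rw [Real.log_mul hrpos.ne' (by linarith), Real.log_rpow hρy, one_div ρy, Real.log_inv]
      ring
    rw [le_div_iff₀ (by positivity)] at hB
    have hBa := le_abs_self B
    have hBn := abs_nonneg B
    refine le_trans (mul_le_mul_of_nonneg_right (max_le_max le_rfl hlogr) (by positivity)) ?_
    rw [max_mul_of_nonneg _ _ (by positivity)]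
    refine max_le (by linarith) ?_
    nlinarith [mul_le_mul_of_nonneg_left hρ2 hlog1]
  have h2 : m * D ^ 2 / (D / ρy * ρx ^ 2) ≤ m * D / ρx ^ 2 := by
    have e : m * D ^ 2 / (D / ρy * ρx ^ 2) = m * D * ρy / ρx ^ 2 := by field_simp
    rw [e]
    exact div_le_div_of_nonneg_right (mul_le_of_le_one_right (by positivity) hρy1) (by positivity)
  have hS : m ^ 2 * R / ρx ^ 2 + m * D ^ 2 / (D / ρy * ρx ^ 2) +
      logOnePlus (OmegaXi m Lx Ly (D / ρy)) ≤
      (m ^ 2 * R + m * D + (1 + Real.log (OmegaXi m Lx Ly D) + |B|)) / ρx ^ 2 := by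
    rw [add_div, add_div]
    linarith
  rw [hrx]
  refine (mul_le_mul h0 hS ?_ (by positivity)).trans_eq (by ring)
  have := one_le_logOnePlus (OmegaXi m Lx Ly (D / ρy))
  positivity

end Arithmetic

/-! ### The universal complexity bound. -/

section Bound

variable {E F : Type*} [NormedAddCommGroup E] [InnerProductSpace ℝ E] [CompleteSpace E]
  [NormedAddCommGroup F] [InnerProductSpace ℝ F]
  {P : MinMaxProblem E F} {m Lx Ly ξ : ℝ} {y₀ : F} {O : Oracle E F} {x₀ : E}

namespace MinMaxProblem.Assumptions

lemma sInf_phat_le (hP : P.Assumptions m Lx Ly) {x : E} (hx : x ∈ P.X) :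
    sInf (P.phat '' P.X) ≤ P.phat x :=
  csInf_le hP.bddBelow ⟨x, hx, rfl⟩

lemma Rfun_nonneg (hP : P.Assumptions m Lx Ly) {lam : ℝ} (hlam : 0 ≤ lam) :
    0 ≤ Rfun P.X P.phat x₀ lam := by
  refine Real.sInf_nonneg ?_
  rintro _ ⟨x, hx, rfl⟩
  have := sub_nonneg.2 (hP.sInf_phat_le hx)
  positivity

theorem aipps_complexity (hP : P.Assumptions m Lx Ly) (hO : P.IsOracle O) (hx₀ : x₀ ∈ P.X)
    (hy₀ : y₀ ∈ P.Y) {ρ : ℝ} (hρ : 0 < ρ) (hξ : 0 < ξ) :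
    ∃ (x u : E) (q : ℕ), AIPPSHalts O m Lx Ly ξ x₀ y₀ ρ x u q ∧
      P.IsAIPPSOutput m Lx Ly ξ x₀ y₀ ρ x u ∧
      (q : ℝ) ≤ 2000000 * (OmegaXi m Lx Ly ξ *
        (m ^ 2 * Rfun P.X P.phat x₀ (1 / (4 * m)) / ρ ^ 2 + m * P.Dy ^ 2 / (ξ * ρ ^ 2) +
          logOnePlus (OmegaXi m Lx Ly ξ))) := by
  have hS := hP.aippSetting hξ hρ y₀
  have hm := hP.m_pos
  have hlam := hS.lam_pos
  set p := aippsParams m Lx Ly ξ ρ with hp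
  have hb : ∀ x ∈ P.X, p.lam * (sInf (P.phat '' P.X) - P.Dy ^ 2 / (2 * ξ)) ≤
      p.lam * (P.pXi ξ y₀ x + P.h x) := fun x hx => by
    refine mul_le_mul_of_nonneg_left ?_ hlam.le
    have h1 := hP.p_le_pXi_add hξ hy₀ hx
    have h2 := hP.sInf_phat_le hx
    unfold phat at h2 ⊢
    linarith
  have hδ : 0 < p.lam * p.rhoHat / 5 := by
    have : 0 < p.rhoHat := div_pos hρ (by norm_num)
    positivity
  obtain ⟨K, J, n, x, u, hexec, hout, hK, hJ⟩ := exists_halted hO hP hξ hS hx₀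
    (exists_outerResidual_le hO hP hξ hS hx₀ hδ hb)
  refine ⟨x, u, _, ⟨n, hexec⟩, hout, ?_⟩
  set R := Rfun P.X P.phat x₀ (1 / (4 * m)) with hR_def
  have hR : 0 ≤ R := hP.Rfun_nonneg (by positivity)
  -- The factor `9/10` turns the `5/9` of `outer_count` into the `1/2` in the definition of `R`.
  have hKR : (((K : ℝ) - 1) * ((p.lam * p.rhoHat / 5) ^ 2 / 4) -
      p.lam * (P.Dy ^ 2 / (2 * ξ))) * (9 / 10) ≤ R := by
    refine le_csInf (hP.X_nonempty.image _) ?_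
    rintro _ ⟨x', hx', rfl⟩
    have h1 := outer_count hO hP hξ hS hx₀ hδ.le hb hK hx'
    have h2 := mul_le_mul_of_nonneg_left (hP.pXi_le_p hξ hx' (y₀ := y₀)) hlam.le
    have h3 := mul_nonneg hlam.le (sub_nonneg.2 (hP.sInf_phat_le hx'))
    change _ ≤ ‖x₀ - x'‖ ^ 2 / 2 + p.lam * (P.phat x' - sInf (P.phat '' P.X))
    rw [norm_sub_rev x₀ x']
    unfold phat at h1 h3 ⊢
    linarith
  -- The larger coefficient is `25600 · 10/9 < 30000`; afterwards `63 · 30000 < 2000000`.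
  have hQ : (K : ℝ) - 1 ≤ 30000 * (m ^ 2 * R / ρ ^ 2 + m * P.Dy ^ 2 / (ξ * ρ ^ 2)) := by
    have e1 : (p.lam * p.rhoHat / 5) ^ 2 / 4 = ρ ^ 2 / (25600 * m ^ 2) := by
      change (1 / (4 * m) * (ρ / 4) / 5) ^ 2 / 4 = _
      field_simp
      norm_num
    have e2 : p.lam * (P.Dy ^ 2 / (2 * ξ)) = P.Dy ^ 2 / (8 * m * ξ) := by
      change 1 / (4 * m) * (P.Dy ^ 2 / (2 * ξ)) = _
      field_simp
      ring
    rw [e1, e2] at hKR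
    have h1 : ((K : ℝ) - 1) * (ρ ^ 2 / (25600 * m ^ 2)) ≤
        10 / 9 * R + P.Dy ^ 2 / (8 * m * ξ) := by linarith
    rw [mul_div_assoc', div_le_iff₀ (by positivity)] at h1
    have h2 : (K : ℝ) - 1 ≤ (10 / 9 * R + P.Dy ^ 2 / (8 * m * ξ)) * (25600 * m ^ 2) / ρ ^ 2 := by
      rwa [le_div_iff₀ (by positivity)]
    have e3 : (10 / 9 * R + P.Dy ^ 2 / (8 * m * ξ)) * (25600 * m ^ 2) / ρ ^ 2 =
        256000 / 9 * (m ^ 2 * R / ρ ^ 2) + 3200 * (m * P.Dy ^ 2 / (ξ * ρ ^ 2)) := by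
      field_simp
      ring
    rw [e3] at h2
    have h3 : 0 ≤ m ^ 2 * R / ρ ^ 2 := by positivity
    have h4 : 0 ≤ m * P.Dy ^ 2 / (ξ * ρ ^ 2) := by positivity
    linarith
  have hs1 : 1 ≤ √(2 * p.lam * p.M + 1) := by
    rw [Real.one_le_sqrt, mul_assoc]
    have := hS.lam_mul_M_pos
    linarith
  have hΩ := one_le_OmegaXi (m := m) (Lx := Lx) (ξ := ξ) hP.Ly_pos.le
  have hl := one_le_logOnePlus (OmegaXi m Lx Ly ξ)
  have hq := evaluations_le hs1 (sqrt_le_OmegaXi hm hP.m_le hP.Ly_pos.le hξ) hQ (by positivity) hJ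
  refine hq.trans ?_
  rw [mul_left_comm (2000000 : ℝ)]
  refine mul_le_mul_of_nonneg_left ?_ (by linarith)
  have h3 : 0 ≤ m ^ 2 * R / ρ ^ 2 := by positivity
  have h4 : 0 ≤ m * P.Dy ^ 2 / (ξ * ρ ^ 2) := by positivity
  linarith

end MinMaxProblem.Assumptions

end Bound

end MinMaxSmoothing

theorem proposition3p2 :
    ∃ C : ℝ, 0 < C ∧ ∃ C' : ℝ → ℝ → ℝ → ℝ → ℝ → ℝ → ℝ,
    ∀ (E F : Type*)
      [NormedAddCommGroup E] [InnerProductSpace ℝ E] [FiniteDimensional ℝ E] [CompleteSpace E]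
      [NormedAddCommGroup F] [InnerProductSpace ℝ F] [FiniteDimensional ℝ F]
      (P : MinMaxSmoothing.MinMaxProblem E F) (m Lx Ly : ℝ), P.Assumptions m Lx Ly →
    ∀ x₀ ∈ P.X, ∀ y₀ ∈ P.Y, ∀ ρx ρy ξ : ℝ, 0 < ρx → 0 < ρy → 0 < ξ → P.Dy / ρy ≤ ξ →
      -- (a)
      (∀ O : MinMaxSmoothing.Oracle E F, P.IsOracle O →
        ∃ (x u : E) (q : ℕ),
          MinMaxSmoothing.AIPPSHalts O m Lx Ly ξ x₀ y₀ ρx x u q ∧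
          P.IsAIPPSOutput m Lx Ly ξ x₀ y₀ ρx x u ∧
          (q : ℝ) ≤ C * (MinMaxSmoothing.OmegaXi m Lx Ly ξ *
            (m ^ 2 * MinMaxSmoothing.Rfun P.X P.phat x₀ (1 / (4 * m)) / ρx ^ 2 +
              m * P.Dy ^ 2 / (ξ * ρx ^ 2) +
              MinMaxSmoothing.logOnePlus (MinMaxSmoothing.OmegaXi m Lx Ly ξ))) ∧
          (ξ = P.Dy / ρy → ρx ≤ 1 → ρy ≤ 1 → ∀ B : ℝ, Real.log (1 / ρy) ≤ B / ρx ^ 2 →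
            (q : ℝ) ≤ C' m Lx Ly P.Dy (MinMaxSmoothing.Rfun P.X P.phat x₀ (1 / (4 * m))) B *
              (ρx ^ (-2 : ℝ) * ρy ^ (-(1 / 2) : ℝ)))) ∧
      -- (b)
      ∀ x u : E, P.IsAIPPSOutput m Lx Ly ξ x₀ y₀ ρx x u →
        P.IsPrimalDualStationary ρx ρy u ((1 / ξ) • (y₀ - P.yXi ξ y₀ x)) x (P.yXi ξ y₀ x) := by
  refine ⟨2000000, by norm_num, fun m Lx Ly D R B => 2000000 * (MinMaxSmoothing.OmegaXi m Lx Ly D *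
    (m ^ 2 * R + m * D + (1 + Real.log (MinMaxSmoothing.OmegaXi m Lx Ly D) + |B|))), ?_⟩
  intro E F _ _ _ _ _ _ _ P m Lx Ly hP x₀ hx₀ y₀ hy₀ ρx ρy ξ hρx hρy hξ hD
  refine ⟨fun O hO => ?_, fun x u hout =>
    hP.isPrimalDualStationary hx₀ hy₀ hρx hρy hξ hD hout⟩
  obtain ⟨x, u, q, hhalt, hout, hq⟩ := hP.aipps_complexity hO hx₀ hy₀ hρx hξ
  refine ⟨x, u, q, hhalt, hout, hq, ?_⟩
  rintro rfl hρx1 hρy1 B hB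
  have hm := hP.m_pos
  have hDpos : 0 < P.Dy := by
    have := mul_pos hξ hρy
    rwa [div_mul_cancel₀ _ hρy.ne'] at this
  refine hq.trans ?_
  rw [mul_assoc]
  exact mul_le_mul_of_nonneg_left (MinMaxSmoothing.complexity_div_le hm hP.Ly_pos.le hDpos hρx
    hρx1 hρy hρy1 (hP.Rfun_nonneg (by positivity)) hB) (by norm_num)
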